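/- Let $\Omega=(0,1)^2$, let $q_1,\dots,q_k\in S^2\subset\mathbb R^3$ ($k\ge1$) be distinct, $Q_k=\{\pm q_1,\dots,\pm q_k\}$ and $L_k=\bigcup_{l}\mathrm{span}(q_l)$. Let $G:\mathbb R^3\to[0,\infty)$ be continuous on $\mathbb R^3\setminus\{0\}$, positively zero-homogeneous, with $G(0)=0$ and $\{G=0\}=L_k$. Let $\lambda_n,\delta_n>0$ with $\lambda_n\to0$, $\delta_n\to0$, and let $J_{2,n}\in\mathbb R$ be such that, for some $c>0$, $$\frac{\lambda_n}{\sqrt{\delta_n}}\to0,\qquad J_{2,n}\frac{\lambda_n}{\sqrt{\delta_n}}\ge c\quad\text{for all }n.$$ Let $Z_n=\{j\in\mathbb Z:\lambda_nj\in(0,1)\}$ and $R_n=\{i\in Z_n^2:\ i+2e_1,\,i+e_2\in Z_n^2\}$. An admissible spin field is a map $u:Z_n^2\to S^2$, $i\mapsto u^i$, such that for every $m\in Z_n$, with $a=\min Z_n$ and $b=\max Z_n$, $(u^{(a+1,m)},u^{(a,m)})=(u^{(b,m)},u^{(b-1,m)})$ (no condition when $Z_n$ has fewer than two elements). For such $u$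 put $$H_n(u)=\frac12\Big(\sum_{i\in R_n}\lambda_n^2\big|u^i-2(1-\delta_n)u^{i+e_1}+u^{i+2e_1}\big|^2+J_{2,n}\sum_{i\in R_n}\lambda_n^2|u^{i+e_2}-u^i|^2\Big),$$ $$P_n^G(u)=\delta_n^2\sum_{i\in R_n}\lambda_n^2\,G(u^i\times u^{i+e_1}),$$ and let $T_2(u):\Omega\to\mathbb R^3$ be the piecewise constant function equal to $\frac{u^i\times u^{i+e_1}}{\sqrt{2\delta_n}}$ on $\Omega\cap\lambda_n(i+[0,1)^2)$ whenever $i,i+e_1\in Z_n^2$, and $0$ elsewhere in $\Omega$. For $z\in L^1(\Omega,\mathbb R^3)$ let $H_n^G(z)\in[0,\infty]$ be the infimum of $H_n(u)+P_n^G(u)$ over all admissible spin fields $u$ with $T_2(u)=z$ a.e. in $\Omega$ ($+\infty$ if there is none). Proposition. If $z_n\in L^1(\Omega,\mathbb R^3)$ and, for some constant $C$, $H_n^G(z_n)\le C\lambda_n\delta_n^{3/2}$ for all $n$, then there is a subsequence of $(z_n)$ that converges strongly in $L^1(\Omega,\mathbb R^3)$ to some $z\in BV(\Omega,Q_k)$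 (that is, $z\in L^1(\Omega,\mathbb R^3)$ has finite total variation in $\Omega$ and $z\in Q_k$ a.e.), and $z$ depends only on the first variable: $z(x,y)=v(x)$ for a.e. $(x,y)\in\Omega$, for some $v:(0,1)\to\mathbb R^3$. -/

import Mathlib

open MeasureTheory Filter Topology

namespace HelicalXY

noncomputable section

/-- The spin space `ℝ³` with its Euclidean norm. -/
abbrev E3 : Type := EuclideanSpace ℝ (Fin 3)

/-- The open unit square `Ω = (0,1)²`. -/
def Omega : Set (ℝ × ℝ) := Set.Ioo 0 1 ×ˢ Set.Ioo 0 1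

/-- Lebesgue measure on `Ω`. -/
def muOmega : Measure (ℝ × ℝ) := volume.restrict Omega

/-- The vector product of `ℝ³`. -/
def cross (a b : E3) : E3 := WithLp.toLp 2 (crossProduct a.ofLp b.ofLp)

/-! ### The lattice -/

/-- The integers `j` with `lam * j ∈ (0,1)` (for `lam > 0`, see `mem_idx`). -/
def idx (lam : ℝ) : Finset ℤ := Finset.Ioo 0 ⌈1 / lam⌉

theorem mem_idx {lam : ℝ} (hlam : 0 < lam) (j : ℤ) :
    j ∈ idx lam ↔ lam * (j : ℝ) ∈ Set.Ioo (0 : ℝ) 1 := by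
  rw [idx, Finset.mem_Ioo, Int.lt_ceil, lt_div_iff₀ hlam, Set.mem_Ioo, mul_comm lam (j : ℝ),
    mul_pos_iff_of_pos_right hlam, Int.cast_pos]

/-- `ℤ²ₙ(Ω)`: the indices `i ∈ ℤ²` with `lam * i ∈ Ω`. -/
def idx2 (lam : ℝ) : Finset (ℤ × ℤ) := idx lam ×ˢ idx lam

/-- `Rₙ(Ω)`: the indices `i` such that `i`, `i + 2e₁` and `i + e₂` belong to `ℤ²ₙ(Ω)`. -/
def stencilIdx (lam : ℝ) : Finset (ℤ × ℤ) :=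
  (idx2 lam).filter fun i => i + (2, 0) ∈ idx2 lam ∧ i + (0, 1) ∈ idx2 lam

/-- `u` restricted to `ℤ²ₙ(Ω)` is an admissible spin field: it takes values in the unit sphere and,
on every horizontal line, its first and its last pair of neighbours have the same scalar product.
(Only the values of `u` on `ℤ²ₙ(Ω)` matter.) -/
def IsSpinField (lam : ℝ) (u : ℤ × ℤ → E3) : Prop :=
  (∀ i ∈ idx2 lam, ‖u i‖ = 1) ∧
  ∀ a b m : ℤ, IsLeast (idx lam : Set ℤ) a → IsGreatest (idx lam : Set ℤ) b →
    a < b → m ∈ idx lam →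
    inner ℝ (u (a + 1, m)) (u (a, m)) = inner ℝ (u (b, m)) (u (b - 1, m))

/-! ### The energies -/

/-- The renormalized energy `Hₙ(u)`, with `lam = λₙ`, `del = δₙ`, `J = J_{2,n}`. -/
def energyH (lam del J : ℝ) (u : ℤ × ℤ → E3) : ℝ :=
  (1 / 2) *
    ((∑ i ∈ stencilIdx lam,
        lam ^ 2 * ‖u i - (2 * (1 - del)) • u (i + (1, 0)) + u (i + (2, 0))‖ ^ 2) +
      J * ∑ i ∈ stencilIdx lam, lam ^ 2 * ‖u (i + (0, 1)) - u i‖ ^ 2)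

/-- The penalization `P^G_n(u)`. -/
def energyP (lam del : ℝ) (G : E3 → ℝ) (u : ℤ × ℤ → E3) : ℝ :=
  del ^ 2 * ∑ i ∈ stencilIdx lam, lam ^ 2 * G (cross (u i) (u (i + (1, 0))))

/-- `T₂(u)`: the piecewise constant function equal to `uⁱ × uⁱ⁺ᵉ¹ / √(2δ)` on the cell
`lam * (i + [0,1)²)`, for all `i` such that `i` and `i + e₁` belong to `ℤ²ₙ(Ω)`.
It is set to `0` on the remaining boundary strips (of width at most `lam`). -/
def chirality (lam del : ℝ) (u : ℤ × ℤ → E3) (x : ℝ × ℝ) : E3 :=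
  let i : ℤ × ℤ := (⌊x.1 / lam⌋, ⌊x.2 / lam⌋)
  if i ∈ idx2 lam ∧ i + (1, 0) ∈ idx2 lam then
    (1 / Real.sqrt (2 * del)) • cross (u i) (u (i + (1, 0)))
  else 0

/-- `H^G_n(z)` for `z ∈ L¹(Ω, ℝ³)`: the infimum of `Hₙ(u) + P^G_n(u)` over all admissible spin
fields `u` with `T₂(u) = z`; it is `+∞` when there is no such `u`. -/
def energyHG (lam del J : ℝ) (G : E3 → ℝ) (z : Lp E3 1 muOmega) : ENNReal :=
  ⨅ (u : ℤ × ℤ → E3) (_ : IsSpinField lam u) (_ : z =ᵐ[muOmega] chirality lam del u),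
    ENNReal.ofReal (energyH lam del J u + energyP lam del G u)

/-! ### Wells and penalization density -/

/-- `Q_k = {± q₁, …, ± q_k}`. -/
def wells {k : ℕ} (q : Fin k → E3) : Set E3 := {x | ∃ l, x = q l ∨ x = -q l}

/-- `L_k`, the union of the lines spanned by `q₁, …, q_k`. -/
def lines {k : ℕ} (q : Fin k → E3) : Set E3 := ⋃ l, (Submodule.span ℝ {q l} : Set E3)

/-- `G : ℝ³ → [0,∞)` is continuous off the origin, (positively) zero-homogeneous, `G 0 = 0`, and
its zero set is `L_k`. -/
structure IsPenalty {k : ℕ} (q : Fin k → E3) (G : E3 → ℝ) : Prop where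
  nonneg : ∀ z, 0 ≤ G z
  continuousOn : ContinuousOn G {0}ᶜ
  homogeneous : ∀ t : ℝ, 0 < t → ∀ z, G (t • z) = G z
  map_zero : G 0 = 0
  zeros : {z | G z = 0} = lines q

/-! ### Functions of bounded variation on `Ω` -/

/-- The total variation of `f` on `Ω`: the supremum of `∫_Ω f · div φ` over all
`φ = (φ₁, φ₂) ∈ C¹_c(Ω; ℝ³ˣ²)` with `|φ| ≤ 1` pointwise. -/
def variation (f : ℝ × ℝ → E3) : ENNReal :=
  ⨆ (φ₁ : ℝ × ℝ → E3) (φ₂ : ℝ × ℝ → E3)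
    (_ : ContDiff ℝ 1 φ₁ ∧ HasCompactSupport φ₁ ∧ tsupport φ₁ ⊆ Omega)
    (_ : ContDiff ℝ 1 φ₂ ∧ HasCompactSupport φ₂ ∧ tsupport φ₂ ⊆ Omega)
    (_ : ∀ x, ‖φ₁ x‖ ^ 2 + ‖φ₂ x‖ ^ 2 ≤ 1),
    ENNReal.ofReal (∫ x, inner ℝ (f x) (fderiv ℝ φ₁ x (1, 0) + fderiv ℝ φ₂ x (0, 1)) ∂muOmega)

/-- `f ∈ BV(Ω, Q)`: an `L¹` function of finite total variation with values in `Q` a.e. -/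
def MemBV (Q : Set E3) (f : Lp E3 1 muOmega) : Prop :=
  variation f < ⊤ ∧ ∀ᵐ x ∂muOmega, f x ∈ Q

end

end HelicalXY

open HelicalXY

namespace HelicalXY

/-! ### Vector algebra -/

theorem norm_sq_coord (a : E3) : ‖a‖ ^ 2 = a 0 ^ 2 + a 1 ^ 2 + a 2 ^ 2 := by
  rw [EuclideanSpace.real_norm_sq_eq, Fin.sum_univ_three]

theorem inner_coord (a b : E3) : inner ℝ a b = a 0 * b 0 + a 1 * b 1 + a 2 * b 2 := by
  simp [PiLp.inner_apply, Fin.sum_univ_three, mul_comm]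

theorem cross_zero (a b : E3) : cross a b 0 = a 1 * b 2 - a 2 * b 1 := by
  simp [cross, crossProduct]

theorem cross_one (a b : E3) : cross a b 1 = a 2 * b 0 - a 0 * b 2 := by
  simp [cross, crossProduct]

theorem cross_two (a b : E3) : cross a b 2 = a 0 * b 1 - a 1 * b 0 := by
  simp [cross, crossProduct]

theorem norm_cross_sq (a b : E3) :
    ‖cross a b‖ ^ 2 = ‖a‖ ^ 2 * ‖b‖ ^ 2 - (inner ℝ a b) ^ 2 := by
  simp only [norm_sq_coord, inner_coord, cross_zero, cross_one, cross_two]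
  ring

theorem norm_cross_le (a b : E3) : ‖cross a b‖ ≤ ‖a‖ * ‖b‖ := by
  refine abs_le_of_sq_le_sq' ?_ (by positivity) |>.2
  rw [norm_cross_sq, mul_pow]
  nlinarith [sq_nonneg (inner ℝ a b : ℝ)]

theorem cross_sub_cross (a b a' b' : E3) :
    cross a' b' - cross a b = cross (a' - a) b' + cross a (b' - b) := by
  ext i
  fin_cases i <;> simp [cross_zero, cross_one, cross_two] <;> ring

theorem norm_cross_sub_cross_sq_le {a b a' b' : E3} (ha : ‖a‖ = 1) (hb' : ‖b'‖ = 1) :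
    ‖cross a' b' - cross a b‖ ^ 2 ≤ 2 * (‖a' - a‖ ^ 2 + ‖b' - b‖ ^ 2) := by
  have h1 := norm_cross_le (a' - a) b'
  have h2 := norm_cross_le a (b' - b)
  rw [hb', mul_one] at h1
  rw [ha, one_mul] at h2
  have h3 : ‖cross a' b' - cross a b‖ ≤ ‖a' - a‖ + ‖b' - b‖ := by
    rw [cross_sub_cross]
    exact (norm_add_le _ _).trans (add_le_add h1 h2)
  have h4 := norm_nonneg (cross a' b' - cross a b)
  nlinarith [sq_nonneg (‖a' - a‖ - ‖b' - b‖)]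

/-- For a unit vector `b`, `|v|² = |v × b|² + (v · b)²`; with `v = a - 2(1-d)b + c` the multiple of
`b` drops out of the cross product. -/
theorem norm_second_difference_sq {a b c : E3} (hb : ‖b‖ = 1) (d : ℝ) :
    ‖a - (2 * (1 - d)) • b + c‖ ^ 2 =
      ‖cross b c - cross a b‖ ^ 2 + (inner ℝ a b + inner ℝ b c - 2 * (1 - d)) ^ 2 := by
  have hb2 : b 0 ^ 2 + b 1 ^ 2 + b 2 ^ 2 = 1 := by rw [← norm_sq_coord, hb, one_pow]
  -- Homogenized with `|b|²`, this is Lagrange's identity, a polynomial identity that needs no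
  -- constraint.
  have h : ‖a - (2 * (1 - d)) • b + c‖ ^ 2 * (b 0 ^ 2 + b 1 ^ 2 + b 2 ^ 2) =
      ‖cross b c - cross a b‖ ^ 2 +
        (inner ℝ a b + inner ℝ b c - 2 * (1 - d) * (b 0 ^ 2 + b 1 ^ 2 + b 2 ^ 2)) ^ 2 := by
    simp only [norm_sq_coord, inner_coord, cross_zero, cross_one, cross_two, PiLp.add_apply,
      PiLp.sub_apply, PiLp.smul_apply, smul_eq_mul]
    ring
  rwa [hb2, mul_one, mul_one] at h

/-! ### Coercivity of the energy density -/

/-- The rescaled chirality of a pair of spins. -/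
noncomputable def chi (d : ℝ) (a b : E3) : E3 := (1 / Real.sqrt (2 * d)) • cross a b

/-- The energy density of three consecutive spins: horizontal part and penalization. -/
noncomputable def density (d : ℝ) (G : E3 → ℝ) (a b c : E3) : ℝ :=
  ‖a - (2 * (1 - d)) • b + c‖ ^ 2 + d ^ 2 * G (cross a b)

theorem norm_smul_inv_sqrt_sq {d : ℝ} (hd : 0 < d) (x : E3) :
    2 * d * ‖(1 / Real.sqrt (2 * d)) • x‖ ^ 2 = ‖x‖ ^ 2 := by
  have h2 : (0 : ℝ) < 2 * d := by positivity
  rw [norm_smul, mul_pow, Real.norm_eq_abs, sq_abs, div_pow, Real.sq_sqrt h2.le]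
  field_simp

theorem norm_chi_le {d : ℝ} {a b : E3} (ha : ‖a‖ = 1) (hb : ‖b‖ = 1) :
    ‖chi d a b‖ ≤ 1 / Real.sqrt (2 * d) := by
  have h := norm_cross_le a b
  rw [ha, hb, one_mul] at h
  rw [chi, norm_smul, Real.norm_eq_abs, abs_of_nonneg (by positivity)]
  exact mul_le_of_le_one_right (by positivity) h

theorem norm_chi_sub_chi_sq_le {d : ℝ} (hd : 0 < d) {a b a' b' : E3} (ha : ‖a‖ = 1)
    (hb' : ‖b'‖ = 1) :
    d * ‖chi d a' b' - chi d a b‖ ^ 2 ≤ ‖a' - a‖ ^ 2 + ‖b' - b‖ ^ 2 := by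
  have h := norm_cross_sub_cross_sq_le (a' := a') (b := b) ha hb'
  rw [← norm_smul_inv_sqrt_sq hd, smul_sub] at h
  unfold chi
  linarith

theorem norm_chi_sq {d : ℝ} (hd : 0 < d) {a b : E3} (ha : ‖a‖ = 1) (hb : ‖b‖ = 1) :
    ‖chi d a b‖ ^ 2 = (1 - inner ℝ a b) / d - d * ((1 - inner ℝ a b) / d) ^ 2 / 2 := by
  have h := norm_smul_inv_sqrt_sq hd (cross a b)
  rw [norm_cross_sq, ha, hb] at h
  unfold chi
  have h' : ‖(1 / Real.sqrt (2 * d)) • cross a b‖ ^ 2 = (1 - (inner ℝ a b) ^ 2) / (2 * d) := by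
    rw [eq_div_iff (by positivity)]
    linarith
  rw [h']
  field_simp
  ring

theorem density_eq {d : ℝ} (hd : 0 < d) (G : E3 → ℝ) {a b c : E3} (hb : ‖b‖ = 1) :
    density d G a b c = 2 * d * ‖chi d b c - chi d a b‖ ^ 2 +
      d ^ 2 * ((1 - inner ℝ a b) / d + (1 - inner ℝ b c) / d - 2) ^ 2 +
      d ^ 2 * G (cross a b) := by
  rw [density, norm_second_difference_sq hb, chi, chi, ← smul_sub, norm_smul_inv_sqrt_sq hd,
    ← mul_pow]
  have h : (inner ℝ a b + inner ℝ b c - 2 * (1 - d) : ℝ) =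
      -(d * ((1 - inner ℝ a b) / d + (1 - inner ℝ b c) / d - 2)) := by
    field_simp
    ring
  rw [h, neg_sq]

theorem inner_le_one_of_norm_one {a b : E3} (ha : ‖a‖ = 1) (hb : ‖b‖ = 1) :
    (inner ℝ a b : ℝ) ≤ 1 := by
  simpa [ha, hb] using real_inner_le_norm a b

/-- Follows from `‖w‖² ≤ t` and `(t + t' - 2)² ≤ density / d²`. It is needed at sites far from the
wells: their area is of order `l / r`, and multiplied by the crude bound `1 / √(2d)` this need not
be small. -/
theorem norm_chi_le_density {d : ℝ} (hd : 0 < d) {G : E3 → ℝ} (hG : ∀ x, 0 ≤ G x) {a b c : E3}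
    (ha : ‖a‖ = 1) (hb : ‖b‖ = 1) (hc : ‖c‖ = 1) :
    ‖chi d a b‖ ≤ 3 + density d G a b c / d ^ 2 := by
  have h1 := norm_chi_sq hd ha hb
  have h2 := density_eq hd G (a := a) (c := c) hb
  set t := (1 - inner ℝ a b) / d
  have ht' : 0 ≤ (1 - inner ℝ b c) / d :=
    div_nonneg (sub_nonneg.2 (inner_le_one_of_norm_one hb hc)) hd.le
  set t' := (1 - inner ℝ b c) / d
  have h3 : (t + t' - 2) ^ 2 ≤ density d G a b c / d ^ 2 := by
    rw [le_div_iff₀ (by positivity), h2]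
    have := hG (cross a b)
    have : 0 ≤ 2 * d * ‖chi d b c - chi d a b‖ ^ 2 := by positivity
    have : 0 ≤ d ^ 2 * G (cross a b) := by positivity
    linarith
  have h4 : 0 ≤ d * t ^ 2 / 2 := by positivity
  nlinarith [sq_nonneg (‖chi d a b‖ - 1), sq_nonneg (t + t' - 3)]

theorem mem_wells_of_mem_lines {k : ℕ} {q : Fin k → E3} (hq : ∀ l, ‖q l‖ = 1) {e : E3}
    (he : ‖e‖ = 1) (h : e ∈ lines q) : e ∈ wells q := by
  obtain ⟨l, hl⟩ := Set.mem_iUnion.1 h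
  obtain ⟨r, rfl⟩ := Submodule.mem_span_singleton.1 hl
  rw [norm_smul, hq, mul_one, Real.norm_eq_abs] at he
  rcases eq_or_eq_neg_of_abs_eq he with rfl | rfl
  · exact ⟨l, Or.inl (one_smul _ _)⟩
  · exact ⟨l, Or.inr (by rw [neg_smul, one_smul])⟩

theorem finite_wells {k : ℕ} (q : Fin k → E3) : (wells q).Finite := by
  have : wells q = Set.range q ∪ Set.range (fun l => -q l) := by
    ext x
    simp only [wells, Set.mem_ofPred_eq, Set.mem_union, Set.mem_range, ← exists_or, eq_comm]
  rw [this]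
  exact (Set.finite_range _).union (Set.finite_range _)

theorem norm_of_mem_wells {k : ℕ} {q : Fin k → E3} (hq : ∀ l, ‖q l‖ = 1) {p : E3}
    (hp : p ∈ wells q) : ‖p‖ = 1 := by
  obtain ⟨l, rfl | rfl⟩ := hp
  · exact hq l
  · rw [norm_neg, hq l]

/-- `G` is continuous and positive on the compact part of the sphere at distance at least `η` from
the wells, so it attains a positive minimum there. -/
theorem IsPenalty.exists_pos_le {k : ℕ} {q : Fin k → E3} {G : E3 → ℝ} (hG : IsPenalty q G)
    (hq : ∀ l, ‖q l‖ = 1) {η : ℝ} (hη : 0 < η) :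
    ∃ μ > 0, ∀ e : E3, ‖e‖ = 1 → (∀ p ∈ wells q, η ≤ dist e p) → μ ≤ G e := by
  set K : Set E3 := Metric.sphere 0 1 ∩ ⋂ p ∈ wells q, {e | η ≤ dist e p} with hK
  have hKc : IsCompact K := by
    refine (isCompact_sphere _ _).inter_right (isClosed_biInter fun p _ => ?_)
    exact isClosed_le continuous_const (continuous_id.dist continuous_const)
  have hcont : ContinuousOn G K := hG.continuousOn.mono fun e he => by
    have h1 : ‖e‖ = 1 := by simpa using he.1
    rintro rfl
    simp at h1
  rcases K.eq_empty_or_nonempty with h0 | hne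
  · refine ⟨1, one_pos, fun e he hp => ?_⟩
    have : e ∈ K := ⟨by simpa using he, by simpa using hp⟩
    rw [h0] at this
    exact this.elim
  · obtain ⟨e₀, he₀, hmin⟩ := hKc.exists_isMinOn hne hcont
    have h1 : ‖e₀‖ = 1 := by simpa using he₀.1
    refine ⟨G e₀, lt_of_le_of_ne (hG.nonneg _) fun h => ?_, fun e he hp =>
      hmin ⟨by simpa using he, by simpa using hp⟩⟩
    have h2 : e₀ ∈ lines q := by
      rw [← hG.zeros]
      exact h.symm
    have h3 := he₀.2
    simp only [Set.mem_iInter, Set.mem_ofPred_eq] at h3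
    have := h3 e₀ (mem_wells_of_mem_lines hq h1 h2)
    rw [dist_self] at this
    linarith

/-- If none of the three terms of `density_eq` is of order `d²`, then either `w = 0` or its
direction is close to a well, `t + t'` is close to 2, and `‖w‖` is close to `‖w'‖`. Since `‖w‖² ≈ t`
and `‖w'‖² ≈ t'` for small `d`, this forces `‖w‖ ≈ 1`, so `w` itself is close to a well. -/
theorem IsPenalty.density_coercive {k : ℕ} {q : Fin k → E3} {G : E3 → ℝ} (hG : IsPenalty q G)
    (hq : ∀ l, ‖q l‖ = 1) {η : ℝ} (hη : 0 < η) (hη1 : η ≤ 1) :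
    ∃ κ > 0, ∃ d₀ > 0, ∀ d, 0 < d → d ≤ d₀ → ∀ a b c : E3, ‖a‖ = 1 → ‖b‖ = 1 → ‖c‖ = 1 →
      (∀ p ∈ wells q, η ≤ dist (chi d a b) p) → κ * d ^ 2 ≤ density d G a b c := by
  obtain ⟨μ, hμ, hGμ⟩ := hG.exists_pos_le hq (half_pos hη)
  refine ⟨min (η ^ 2 / 128) μ, by positivity, η / 36, by positivity, ?_⟩
  intro d hd hd0 a b c ha hb hc hfar
  have hw := norm_chi_sq hd ha hb
  have hw' := norm_chi_sq hd hb hc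
  rw [density_eq hd G hb]
  have ht : 0 ≤ (1 - inner ℝ a b) / d :=
    div_nonneg (sub_nonneg.2 (inner_le_one_of_norm_one ha hb)) hd.le
  have ht' : 0 ≤ (1 - inner ℝ b c) / d :=
    div_nonneg (sub_nonneg.2 (inner_le_one_of_norm_one hb hc)) hd.le
  have hGc : G (chi d a b) = G (cross a b) := hG.homogeneous _ (by positivity) _
  have hGn := hG.nonneg (cross a b)
  have htri : |‖chi d b c‖ - ‖chi d a b‖| ≤ ‖chi d b c - chi d a b‖ := abs_norm_sub_norm_le _ _
  set t := (1 - inner ℝ a b) / d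
  set t' := (1 - inner ℝ b c) / d
  set w := chi d a b
  set w' := chi d b c
  have hA : 0 ≤ 2 * d * ‖w' - w‖ ^ 2 := by positivity
  have hB : 0 ≤ d ^ 2 * (t + t' - 2) ^ 2 := by positivity
  have hC : 0 ≤ d ^ 2 * G (cross a b) := by positivity
  have hκ1 : min (η ^ 2 / 128) μ * d ^ 2 ≤ η ^ 2 / 128 * d ^ 2 := by
    gcongr; exact min_le_left _ _
  have hκ2 : min (η ^ 2 / 128) μ * d ^ 2 ≤ μ * d ^ 2 := by
    gcongr; exact min_le_right _ _
  by_cases h1 : μ ≤ G (cross a b)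
  · nlinarith [sq_nonneg d]
  by_cases h2 : η / 4 ≤ |t + t' - 2|
  · have : (η / 4) ^ 2 ≤ (t + t' - 2) ^ 2 := by
      rw [← sq_abs (t + t' - 2)]; gcongr
    nlinarith [sq_nonneg d, sq_nonneg η]
  by_cases h3 : η / 16 ≤ ‖w' - w‖
  · have : (η / 16) ^ 2 ≤ ‖w' - w‖ ^ 2 := by gcongr
    have h4 : η ^ 2 / 128 * d ^ 2 ≤ η ^ 2 / 128 * d := by
      gcongr; nlinarith
    nlinarith
  exfalso
  push Not at h1 h2 h3
  have hnorm : η / 2 ≤ |‖w‖ - 1| := by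
    -- At the origin `G` vanishes and gives no information, but there the norm is at distance 1 from
    -- 1.
    by_cases hw0 : w = 0
    · rw [hw0, norm_zero]; norm_num; linarith
    · have hwn : 0 < ‖w‖ := norm_pos_iff.2 hw0
      have hGe : G (‖w‖⁻¹ • w) < μ := by
        rw [hG.homogeneous _ (by positivity), hGc]; exact h1
      by_contra hcon
      push Not at hcon
      refine absurd (hGμ (‖w‖⁻¹ • w) ?_ fun p hp => ?_) (not_le.2 hGe)
      · rw [norm_smul, norm_inv, norm_norm, inv_mul_cancel₀ hwn.ne']
      · have h5 := hfar p hp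
        have h6 : dist w (‖w‖⁻¹ • w) = |‖w‖ - 1| := by
          rw [dist_eq_norm]
          have : w - ‖w‖⁻¹ • w = (1 - ‖w‖⁻¹) • w := by rw [sub_smul, one_smul]
          rw [this, norm_smul, Real.norm_eq_abs]
          conv_lhs => rw [← abs_of_pos hwn, ← abs_mul, abs_of_pos hwn]
          rw [sub_mul, inv_mul_cancel₀ hwn.ne', one_mul]
        have := dist_triangle w (‖w‖⁻¹ • w) p
        linarith
  have hsq : η / 2 ≤ |‖w‖ ^ 2 - 1| := by
    have : ‖w‖ ^ 2 - 1 = (‖w‖ - 1) * (‖w‖ + 1) := by ring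
    rw [this, abs_mul, abs_of_pos (by positivity : 0 < ‖w‖ + 1)]
    exact hnorm.trans (le_mul_of_one_le_right (abs_nonneg _) (by linarith [norm_nonneg w]))
  have hn := norm_nonneg w
  have hn' := norm_nonneg w'
  rw [abs_lt] at h2
  have ht3 : t ≤ 3 := by linarith
  have ht3' : t' ≤ 3 := by linarith
  have hdt : 0 ≤ d * t ^ 2 := by positivity
  have hdt' : 0 ≤ d * t' ^ 2 := by positivity
  have hdt9 : d * t ^ 2 ≤ η / 36 * 3 ^ 2 := by gcongr
  have hdt9' : d * t' ^ 2 ≤ η / 36 * 3 ^ 2 := by gcongr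
  have hw2 : ‖w‖ ≤ 2 := (sq_le_sq₀ hn zero_le_two).1 (by linarith)
  have hw2' : ‖w'‖ ≤ 2 := (sq_le_sq₀ hn' zero_le_two).1 (by linarith)
  obtain ⟨hl, hr⟩ := abs_le.1 htri
  have hdiff : |‖w'‖ ^ 2 - ‖w‖ ^ 2| ≤ 4 * ‖w' - w‖ := by
    have : ‖w'‖ ^ 2 - ‖w‖ ^ 2 = (‖w'‖ - ‖w‖) * (‖w'‖ + ‖w‖) := by ring
    rw [this, abs_mul, abs_of_nonneg (by positivity : 0 ≤ ‖w'‖ + ‖w‖), mul_comm]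
    exact mul_le_mul (by linarith) htri (abs_nonneg _) (by norm_num)
  obtain ⟨hl', hr'⟩ := abs_le.1 hdiff
  -- `2(‖w‖² - 1)` is at most `3η/4` in modulus: `η/4` from `h2`, `η/4` from `d t²/2` and `d t'²/2`
  -- together, `η/4` from `hdiff` and `h3`. But `hsq` asks for `η`.
  rcases le_abs.1 hsq with h | h <;> linarith

/-! ### Transitions between separated wells -/

section Transition

variable {X : Type*} [PseudoMetricSpace X]

open scoped Classical in
/-- The indicator of the points at distance at least `ρ` from `Q`. -/
noncomputable def far (Q : Set X) (ρ : ℝ) (x : X) : ℝ := if ∀ p ∈ Q, ρ ≤ dist x p then 1 else 0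

theorem far_nonneg (Q : Set X) (ρ : ℝ) (x : X) : 0 ≤ far Q ρ x := by
  unfold far; split_ifs <;> norm_num

theorem far_of_forall {Q : Set X} {ρ : ℝ} {x : X} (h : ∀ p ∈ Q, ρ ≤ dist x p) :
    far Q ρ x = 1 := if_pos h

/-- A bound for the variation of the truncated distances to the points of `Q` along a step. -/
noncomputable def stepCost (Q : Set X) (ρ θ : ℝ) (x y : X) : ℝ :=
  (θ + 1 / ρ) * dist y x ^ 2 + (1 / θ) * (far Q ρ x + far Q ρ y)

theorem stepCost_nonneg (Q : Set X) {ρ θ : ℝ} (hρ : 0 < ρ) (hθ : 0 < θ) (x y : X) :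
    0 ≤ stepCost Q ρ θ x y := by
  have := far_nonneg Q ρ x
  have := far_nonneg Q ρ y
  unfold stepCost
  positivity

/-- The distance to `p`, truncated below at `ρ` and above at `2ρ`. -/
noncomputable def clampDist (ρ : ℝ) (p x : X) : ℝ := max ρ (min (dist x p) (2 * ρ))

theorem abs_clampDist_sub_le (ρ : ℝ) (p x y : X) :
    |clampDist ρ p y - clampDist ρ p x| ≤ dist y x := by
  have h := abs_dist_sub_le y x p
  refine le_trans ?_ h
  unfold clampDist
  calc _ ≤ |min (dist y p) (2 * ρ) - min (dist x p) (2 * ρ)| := by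
        simpa using abs_max_sub_max_le_max ρ (min (dist y p) (2 * ρ)) ρ (min (dist x p) (2 * ρ))
    _ ≤ _ := by
        simpa using abs_min_sub_min_le_max (dist y p) (2 * ρ) (dist x p) (2 * ρ)

theorem clampDist_of_dist_lt {Q : Set X} {ρ : ℝ}
    (hsep : ∀ p ∈ Q, ∀ p' ∈ Q, p ≠ p' → 4 * ρ ≤ dist p p') {p p' x : X} (hp : p ∈ Q)
    (hp' : p' ∈ Q) (hx : dist x p' < ρ) [Decidable (p' = p)] :
    clampDist ρ p x = if p' = p then ρ else 2 * ρ := by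
  have hρ : 0 < ρ := dist_nonneg.trans_lt hx
  unfold clampDist
  split_ifs with h
  · subst h
    rw [min_eq_left (by linarith), max_eq_left hx.le]
  · have h1 := hsep p' hp' p hp h
    have h2 := dist_triangle_left p' p x
    rw [min_eq_right (by linarith), max_eq_right (by linarith)]

/-- Let `s` be the length of the step. If an endpoint is far from `Q`, then `s ≤ θ s² + 1/θ`
suffices. Two endpoints near the same well have equal truncated distances. Endpoints near different
wells are at least `ρ` apart, so `s ≤ s²/ρ`: this direct jump, possible on a lattice, is the reason
for the term `1 / ρ` in `stepCost`. -/
theorem abs_clampDist_sub_le_stepCost {Q : Set X} {ρ θ : ℝ} (hρ : 0 < ρ) (hθ : 0 < θ)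
    (hsep : ∀ p ∈ Q, ∀ p' ∈ Q, p ≠ p' → 4 * ρ ≤ dist p p') {p : X} (hp : p ∈ Q) (x y : X) :
    |clampDist ρ p y - clampDist ρ p x| ≤ stepCost Q ρ θ x y := by
  classical
  have h := abs_clampDist_sub_le ρ p x y
  have hd : 0 ≤ dist y x := dist_nonneg
  have hx0 := far_nonneg Q ρ x
  have hy0 := far_nonneg Q ρ y
  have h2 : 0 ≤ (1 / ρ) * dist y x ^ 2 := by positivity
  have h3 : dist y x ≤ θ * dist y x ^ 2 + 1 / θ := by
    have : θ * dist y x ^ 2 + 1 / θ - dist y x =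
        (1 / θ) * ((θ * dist y x - 1 / 2) ^ 2 + 3 / 4) := by
      field_simp; ring
    have : 0 ≤ (1 / θ) * ((θ * dist y x - 1 / 2) ^ 2 + 3 / 4) := by positivity
    linarith
  have hθ' : 0 < 1 / θ := by positivity
  by_cases hx : ∀ p ∈ Q, ρ ≤ dist x p
  · rw [stepCost, far_of_forall hx]
    nlinarith
  by_cases hy : ∀ p ∈ Q, ρ ≤ dist y p
  · rw [stepCost, far_of_forall hy]
    nlinarith
  push Not at hx hy
  obtain ⟨p₁, hp₁, hx⟩ := hx
  obtain ⟨p₂, hp₂, hy⟩ := hy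
  by_cases h12 : p₁ = p₂
  · subst h12
    rw [clampDist_of_dist_lt hsep hp hp₁ hx, clampDist_of_dist_lt hsep hp hp₁ hy, sub_self,
      abs_zero]
    exact stepCost_nonneg Q hρ hθ x y
  · have h4 := hsep p₁ hp₁ p₂ hp₂ h12
    have h6 : ρ ≤ dist y x := by
      rw [dist_comm x p₁] at hx
      have := dist_triangle p₁ x y
      have := dist_triangle p₁ y p₂
      rw [dist_comm y x]
      linarith
    have h7 : dist y x ≤ (1 / ρ) * dist y x ^ 2 := by
      rw [one_div, ← div_eq_inv_mul, le_div_iff₀ hρ]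
      nlinarith
    have : 0 ≤ θ * dist y x ^ 2 := by positivity
    have : 0 ≤ (1 / θ) * (far Q ρ x + far Q ρ y) := by positivity
    unfold stepCost
    linarith

theorem sum_Ico_add_one {c : ℤ → ℝ} {a m : ℤ} (h : a ≤ m) :
    ∑ i ∈ Finset.Ico a (m + 1), c i = ∑ i ∈ Finset.Ico a m, c i + c m := by
  have : Finset.Ico a (m + 1) = insert m (Finset.Ico a m) := by
    ext i; simp only [Finset.mem_Ico, Finset.mem_insert]; omega
  rw [this, Finset.sum_insert (by simp), add_comm]

theorem abs_sub_le_sum_Ico {g c : ℤ → ℝ} {a b : ℤ} (hab : a ≤ b)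
    (h : ∀ i, |g (i + 1) - g i| ≤ c i) : |g b - g a| ≤ ∑ i ∈ Finset.Ico a b, c i := by
  induction b, hab using Int.leInduction with
  | base => simp
  | succ m hm ih =>
    rw [sum_Ico_add_one hm]
    calc _ ≤ |g (m + 1) - g m| + |g m - g a| := abs_sub_le _ _ _
      _ ≤ _ := by linarith [h m]

/-- A sequence that passes from one well to another one pays at least `ρ`. -/
theorem eq_of_sum_stepCost_lt {Q : Set X} {ρ θ : ℝ} (hρ : 0 < ρ) (hθ : 0 < θ)
    (hsep : ∀ p ∈ Q, ∀ p' ∈ Q, p ≠ p' → 4 * ρ ≤ dist p p') {f : ℤ → X} {a b : ℤ} (hab : a ≤ b)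
    (hsum : ∑ i ∈ Finset.Ico a b, stepCost Q ρ θ (f i) (f (i + 1)) < ρ) {p p' : X} (hp : p ∈ Q)
    (hp' : p' ∈ Q) (ha : dist (f a) p < ρ) (hb : dist (f b) p' < ρ) : p = p' := by
  classical
  by_contra hne
  have h := abs_sub_le_sum_Ico (g := fun i => clampDist ρ p (f i)) hab
    fun i => abs_clampDist_sub_le_stepCost hρ hθ hsep hp (f i) (f (i + 1))
  simp only [clampDist_of_dist_lt hsep hp hp ha, clampDist_of_dist_lt hsep hp hp' hb,
    if_true, if_neg (Ne.symm hne)] at h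
  have := le_abs_self (2 * ρ - ρ)
  linarith

/-- The phases of a sequence of bounded cost are constant on the level sets of a bounded monotone
function. -/
theorem exists_monotone_phase {Q : Set X} (hQ : Q.Nonempty) {ρ θ : ℝ} (hρ : 0 < ρ) (hθ : 0 < θ)
    (hsep : ∀ p ∈ Q, ∀ p' ∈ Q, p ≠ p' → 4 * ρ ≤ dist p p') {f : ℤ → X} {A : ℤ} {T : ℝ}
    (hT : ∑ i ∈ Finset.Ico 1 A, stepCost Q ρ θ (f i) (f (i + 1)) ≤ T) :
    ∃ S : ℤ → ℕ, Monotone S ∧ (∀ j, S j ≤ ⌊T / (ρ / 2)⌋₊) ∧ ∃ p : ℕ → X, (∀ s, p s ∈ Q) ∧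
      ∀ j ∈ Finset.Icc 1 A, ∀ p' ∈ Q, dist (f j) p' < ρ → p (S j) = p' := by
  classical
  set c : ℤ → ℝ := fun i => stepCost Q ρ θ (f i) (f (i + 1)) with hc
  have hc0 : ∀ i, 0 ≤ c i := fun i => stepCost_nonneg Q hρ hθ _ _
  -- Cumulative cost, frozen beyond `A` so that it is monotone and bounded on all of `ℤ`.
  set E : ℤ → ℝ := fun j => ∑ i ∈ Finset.Ico 1 (min j A), c i with hE
  have hE0 : ∀ j, 0 ≤ E j := fun j => Finset.sum_nonneg fun i _ => hc0 i
  have hEmono : Monotone E := fun j j' hj =>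
    Finset.sum_le_sum_of_subset_of_nonneg
      (Finset.Ico_subset_Ico_right (min_le_min_right A hj)) fun i _ _ => hc0 i
  have hET : ∀ j, E j ≤ T := fun j => le_trans (Finset.sum_le_sum_of_subset_of_nonneg
    (Finset.Ico_subset_Ico_right (min_le_right j A)) fun i _ _ => hc0 i) hT
  have hEsub : ∀ j j', 1 ≤ j → j ≤ j' → j' ≤ A → E j' = E j + ∑ i ∈ Finset.Ico j j', c i := by
    intro j j' h1 h2 h3
    simp only [hE, min_eq_left h3, min_eq_left (h2.trans h3)]
    rw [← Finset.Ico_union_Ico_eq_Ico h1 h2, Finset.sum_union]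
    exact Finset.disjoint_left.2 fun i hi hi' => by
      rw [Finset.mem_Ico] at hi hi'; omega
  -- Between two sites with the same integer part the cost is less than `ρ / 2`, below the price `ρ`
  -- of a change of well.
  set S : ℤ → ℕ := fun j => ⌊E j / (ρ / 2)⌋₊ with hS
  have hphase : ∀ j j', 1 ≤ j → j ≤ j' → j' ≤ A → S j = S j' → ∀ p ∈ Q, ∀ p' ∈ Q,
      dist (f j) p < ρ → dist (f j') p' < ρ → p = p' := by
    intro j j' h1 h2 h3 h4 p hp p' hp' hpj hpj'
    refine eq_of_sum_stepCost_lt hρ hθ hsep h2 ?_ hp hp' hpj hpj'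
    have h5 := hEsub j j' h1 h2 h3
    have h6 : E j' / (ρ / 2) < S j + 1 := by rw [h4]; exact Nat.lt_floor_add_one _
    have h7 : (S j : ℝ) ≤ E j / (ρ / 2) := Nat.floor_le (div_nonneg (hE0 j) (by positivity))
    have h8 : E j' / (ρ / 2) < E j / (ρ / 2) + 1 := by linarith
    rw [div_add_one (by positivity), div_lt_div_iff_of_pos_right (by positivity)] at h8
    linarith
  have hex : ∀ s : ℕ, ∃ p ∈ Q, ∀ j ∈ Finset.Icc 1 A, S j = s → ∀ p' ∈ Q,
      dist (f j) p' < ρ → p = p' := by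
    intro s
    by_cases h : ∃ j ∈ Finset.Icc 1 A, S j = s ∧ ∃ p ∈ Q, dist (f j) p < ρ
    · obtain ⟨j, hj, hjs, p, hp, hpj⟩ := h
      refine ⟨p, hp, fun j' hj' hjs' p' hp' hpj' => ?_⟩
      rw [Finset.mem_Icc] at hj hj'
      rcases le_total j j' with hle | hle
      · exact hphase j j' hj.1 hle hj'.2 (hjs.trans hjs'.symm) p hp p' hp' hpj hpj'
      · exact (hphase j' j hj'.1 hle hj.2 (hjs'.trans hjs.symm) p' hp' p hp hpj' hpj).symm
    -- A level with no site near a well imposes nothing: any well will do.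
    · obtain ⟨p, hp⟩ := hQ
      exact ⟨p, hp, fun j hj hjs p' hp' hpj => absurd ⟨j, hj, hjs, p', hp', hpj⟩ h⟩
  choose p hpQ hp using hex
  refine ⟨S, fun j j' hj => ?_, fun j => ?_, p, hpQ, fun j hj p' hp' hpj => hp _ j hj rfl p' hp' hpj⟩
  · exact Nat.floor_mono (div_le_div_of_nonneg_right (hEmono hj) (by positivity))
  · exact Nat.floor_mono (div_le_div_of_nonneg_right (hET j) (by positivity))

end Transition

/-! ### Phases of a field on a rectangle of the lattice -/

/-- Here `l` plays the role of `λ` and `r` of `√δ`. Averaging over at least `1/(2l)` rows produces a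
row with `∑ e ≤ 2Cr³`, to which `exists_monotone_phase` applies. Summed over the columns, the
vertical cost with parameter `θ` is `O(θ + 1 + 1/(θ l r))`, because the squared differences sum to
at most `C` and there are `O(1/(l r))` far sites. The choice `θ = √(l/r)/l` balances the outer
terms: multiplied by `l`, each becomes `√(l/r)`. -/
theorem exists_phase_columns {X : Type*} [PseudoMetricSpace X] {Q : Set X} (hQ : Q.Nonempty)
    {ρ : ℝ} (hρ : 0 < ρ) (hsep : ∀ p ∈ Q, ∀ p' ∈ Q, p ≠ p' → 4 * ρ ≤ dist p p')
    {κ : ℝ} (hκ : 0 < κ) {C : ℝ} (hC : 0 ≤ C) :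
    ∃ M : ℕ, ∃ K : ℝ, 0 ≤ K ∧ ∀ (l r : ℝ), 0 < l → 0 < r → r ≤ 1 → ∀ A B : ℤ,
      1 / 2 ≤ l * B → ∀ (w : ℤ × ℤ → X) (e : ℤ × ℤ → ℝ),
      (∀ i ∈ Finset.Icc 1 (A + 1) ×ˢ Finset.Icc 1 B, 0 ≤ e i) →
      (∀ i ∈ Finset.Icc 1 (A + 1) ×ˢ Finset.Icc 1 B,
        2 * r ^ 2 * dist (w (i + (1, 0))) (w i) ^ 2 ≤ e i) →
      (∀ i ∈ Finset.Icc 1 (A + 1) ×ˢ Finset.Icc 1 B,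
        (∀ p ∈ Q, ρ ≤ dist (w i) p) → κ * r ^ 4 ≤ e i) →
      ∑ i ∈ Finset.Icc 1 (A + 1) ×ˢ Finset.Icc 1 B, l * e i ≤ C * r ^ 3 →
      ∑ i ∈ Finset.Icc 1 A ×ˢ Finset.Icc 1 B, dist (w (i + (0, 1))) (w i) ^ 2 ≤ C →
      ∃ S : ℤ → ℕ, Monotone S ∧ (∀ j, S j ≤ M) ∧ ∃ p : ℕ → X, (∀ s, p s ∈ Q) ∧
        ∃ D : Finset ℤ, l * D.card ≤ K * (l / r + √(l / r) + l) ∧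
          ∀ i ∈ Finset.Icc 1 A ×ˢ Finset.Icc 1 B, i.1 ∉ D → ∀ p' ∈ Q,
            dist (w i) p' < ρ → p (S i.1) = p' := by
  classical
  -- First the bound on the row cost divided by the quantum `ρ / 2` of `exists_monotone_phase`; then
  -- the sum of the coefficients of the four errors in the estimate of `D`.
  refine ⟨⌊2 * C * (1 / 2 + 1 / (2 * ρ) + 2 / κ) / (ρ / 2)⌋₊,
    2 * C / κ + C / ρ + C / ρ ^ 2 + 2 * C / (ρ * κ), by positivity, ?_⟩
  intro l r hl hr hr1 A B hB w e he0 he1 he2 he3 he4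
  have hB0 : (0 : ℝ) < B := by
    by_contra h
    push Not at h
    nlinarith
  have hB1 : 1 ≤ B := by exact_mod_cast hB0
  have hBne : (Finset.Icc 1 B).Nonempty := ⟨1, by simp [hB1]⟩
  set b : ℤ × ℤ → ℝ := fun i => far Q ρ (w i) with hb
  have hb0 : ∀ i, 0 ≤ b i := fun i => far_nonneg _ _ _
  have hbe : ∀ i ∈ Finset.Icc 1 (A + 1) ×ˢ Finset.Icc 1 B, b i ≤ e i / (κ * r ^ 4) := by
    intro i hi
    by_cases h : ∀ p ∈ Q, ρ ≤ dist (w i) p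
    · simp only [hb, far_of_forall h]
      rw [le_div_iff₀ (by positivity), one_mul]
      exact he2 i hi h
    · simp only [hb, far, if_neg h]
      exact div_nonneg (he0 i hi) (by positivity)
  -- the best row
  obtain ⟨m₀, hm₀, hrow⟩ : ∃ m₀ ∈ Finset.Icc 1 B,
      ∑ j ∈ Finset.Icc 1 (A + 1), e (j, m₀) ≤ 2 * C * r ^ 3 := by
    obtain ⟨m₀, hm₀, h⟩ := Finset.exists_le_of_sum_le (s := Finset.Icc 1 B)
      (f := fun m => ∑ j ∈ Finset.Icc 1 (A + 1), l * e (j, m)) (g := fun _ => C * r ^ 3 / B) hBne (by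
        rw [← Finset.sum_product_right', Finset.sum_const, Int.card_Icc, nsmul_eq_mul]
        have : (((B + 1 - 1).toNat : ℕ) : ℝ) = B := by
          rw [add_sub_cancel_right]
          exact_mod_cast congrArg (Int.cast : ℤ → ℝ) (Int.toNat_of_nonneg (by omega : 0 ≤ B))
        rw [this, mul_div_cancel₀ _ hB0.ne']
        exact he3)
    refine ⟨m₀, hm₀, ?_⟩
    rw [← Finset.mul_sum, le_div_iff₀ hB0] at h
    have h0 : 0 ≤ ∑ j ∈ Finset.Icc 1 (A + 1), e (j, m₀) :=
      Finset.sum_nonneg fun j hj => he0 _ (Finset.mk_mem_product hj hm₀)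
    nlinarith
  have hrowmem : ∀ j ∈ Finset.Icc 1 (A + 1),
      (j, m₀) ∈ Finset.Icc 1 (A + 1) ×ˢ Finset.Icc 1 B := fun j hj => Finset.mk_mem_product hj hm₀
  have hrowpart : ∀ s : Finset ℤ, s ⊆ Finset.Icc 1 (A + 1) →
      ∑ j ∈ s, e (j, m₀) ≤ 2 * C * r ^ 3 := fun s hs =>
    (Finset.sum_le_sum_of_subset_of_nonneg hs fun j hj _ => he0 _ (hrowmem j hj)).trans hrow
  -- With `θ = 1 / r` the difference term is of order `(1/r) · e/r²` and the far term of order `r ·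
  -- e/r⁴`: both are `e/r³`.
  have hrowcost : ∑ j ∈ Finset.Ico 1 A, stepCost Q ρ (1 / r) (w (j, m₀)) (w (j + 1, m₀)) ≤
      2 * C * (1 / 2 + 1 / (2 * ρ) + 2 / κ) := by
    have hterm : ∀ j ∈ Finset.Ico 1 A, stepCost Q ρ (1 / r) (w (j, m₀)) (w (j + 1, m₀)) ≤
        (1 / 2 + 1 / (2 * ρ)) / r ^ 3 * e (j, m₀) +
          1 / (κ * r ^ 3) * (e (j, m₀) + e (j + 1, m₀)) := by
      intro j hj
      rw [Finset.mem_Ico] at hj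
      have hj1 := hrowmem j (Finset.mem_Icc.2 ⟨hj.1, by omega⟩)
      have hj2 := hrowmem (j + 1) (Finset.mem_Icc.2 ⟨by omega, by omega⟩)
      have h1 : 2 * r ^ 2 * dist (w (j + 1, m₀)) (w (j, m₀)) ^ 2 ≤ e (j, m₀) := by
        simpa using he1 _ hj1
      have h2 := hbe _ hj1
      have h3 := hbe _ hj2
      have h4 := he0 _ hj1
      rw [stepCost]
      refine add_le_add ?_ ?_
      · have h5 : dist (w (j + 1, m₀)) (w (j, m₀)) ^ 2 ≤ e (j, m₀) / (2 * r ^ 2) := by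
          rw [le_div_iff₀ (by positivity)]; linarith
        have h6 : 1 / r + 1 / ρ ≤ (1 + 1 / ρ) / r := by
          rw [add_div]
          exact add_le_add_right (le_div_self (by positivity) hr hr1) _
        calc (1 / r + 1 / ρ) * dist (w (j + 1, m₀)) (w (j, m₀)) ^ 2
            ≤ (1 + 1 / ρ) / r * (e (j, m₀) / (2 * r ^ 2)) := by
              gcongr
          _ = _ := by field_simp
      · calc 1 / (1 / r) * (b (j, m₀) + b (j + 1, m₀))
            ≤ 1 / (1 / r) * (e (j, m₀) / (κ * r ^ 4) + e (j + 1, m₀) / (κ * r ^ 4)) := by gcongr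
          _ = _ := by field_simp
    refine (Finset.sum_le_sum hterm).trans ?_
    rw [Finset.sum_add_distrib, ← Finset.mul_sum, ← Finset.mul_sum, Finset.sum_add_distrib]
    have h1 := hrowpart (Finset.Ico 1 A) fun j hj => by
      rw [Finset.mem_Ico] at hj; rw [Finset.mem_Icc]; omega
    have h2 : ∑ j ∈ Finset.Ico 1 A, e (j + 1, m₀) ≤ 2 * C * r ^ 3 := by
      have := hrowpart ((Finset.Ico 1 A).map (addRightEmbedding 1)) fun j hj => by
        rw [Finset.mem_map] at hj
        obtain ⟨i, hi, rfl⟩ := hj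
        rw [Finset.mem_Ico] at hi
        rw [Finset.mem_Icc, addRightEmbedding_apply]
        omega
      rwa [Finset.sum_map] at this
    calc _ ≤ (1 / 2 + 1 / (2 * ρ)) / r ^ 3 * (2 * C * r ^ 3) +
          1 / (κ * r ^ 3) * (2 * C * r ^ 3 + 2 * C * r ^ 3) := by gcongr
      _ = _ := by field_simp; ring
  obtain ⟨S, hSmono, hSM, p, hpQ, hp⟩ := exists_monotone_phase hQ hρ (by positivity : 0 < 1 / r)
    hsep (f := fun j => w (j, m₀)) hrowcost
  -- the columns
  set θ : ℝ := √(l / r) / l with hθ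
  have hsq : 0 < √(l / r) := Real.sqrt_pos.2 (by positivity)
  have hθ0 : 0 < θ := by positivity
  set cc : ℤ → ℝ := fun j => ∑ m ∈ Finset.Ico 1 B, stepCost Q ρ θ (w (j, m)) (w (j, m + 1)) with hcc
  have hcc0 : ∀ j, 0 ≤ cc j := fun j =>
    Finset.sum_nonneg fun m _ => stepCost_nonneg Q hρ hθ0 _ _
  -- Discarded columns: those where the good row is far from the wells, so that no phase can be read
  -- off, and those whose vertical cost could pay for a change of phase.
  set D : Finset ℤ := (Finset.Icc 1 A).filter fun j =>
    (∀ p ∈ Q, ρ ≤ dist (w (j, m₀)) p) ∨ ρ ≤ cc j with hD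
  refine ⟨S, hSmono, hSM, p, hpQ, D, ?_, ?_⟩
  · have hcard : (D.card : ℝ) ≤ ∑ j ∈ Finset.Icc 1 A, (b (j, m₀) + cc j / ρ) := by
      have h1 : (D.card : ℝ) = ∑ j ∈ D, 1 := by simp
      rw [h1]
      refine (Finset.sum_le_sum fun j hj => ?_).trans
        (Finset.sum_le_sum_of_subset_of_nonneg (Finset.filter_subset _ _) fun j _ _ =>
          add_nonneg (hb0 _) (div_nonneg (hcc0 j) hρ.le))
      rcases (Finset.mem_filter.1 hj).2 with h | h
      · have := div_nonneg (hcc0 j) hρ.le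
        simp only [hb, far_of_forall h]
        linarith
      · have := (one_le_div hρ).2 h
        linarith [hb0 (j, m₀)]
    have hsum1 : ∑ j ∈ Finset.Icc 1 A, b (j, m₀) ≤ 2 * C / (κ * r) := by
      calc _ ≤ ∑ j ∈ Finset.Icc 1 A, e (j, m₀) / (κ * r ^ 4) :=
            Finset.sum_le_sum fun j hj => hbe _ (hrowmem j (by
              rw [Finset.mem_Icc] at hj ⊢; omega))
        _ ≤ 2 * C * r ^ 3 / (κ * r ^ 4) := by
            rw [← Finset.sum_div]
            gcongr
            exact hrowpart _ fun j hj => by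
              rw [Finset.mem_Icc] at hj ⊢; omega
        _ = _ := by field_simp
    have hball : ∑ i ∈ Finset.Icc 1 (A + 1) ×ˢ Finset.Icc 1 B, b i ≤ C / (l * κ * r) := by
      calc _ ≤ ∑ i ∈ Finset.Icc 1 (A + 1) ×ˢ Finset.Icc 1 B, e i / (κ * r ^ 4) :=
            Finset.sum_le_sum hbe
        _ = (∑ i ∈ Finset.Icc 1 (A + 1) ×ˢ Finset.Icc 1 B, l * e i) / (l * (κ * r ^ 4)) := by
            rw [← Finset.sum_div, ← Finset.mul_sum, mul_div_mul_left _ _ hl.ne']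
        _ ≤ C * r ^ 3 / (l * (κ * r ^ 4)) := by gcongr
        _ = _ := by field_simp
    have hsub : ∀ s : Finset (ℤ × ℤ), s ⊆ Finset.Icc 1 (A + 1) ×ˢ Finset.Icc 1 B →
        ∑ i ∈ s, b i ≤ C / (l * κ * r) := fun s hs =>
      (Finset.sum_le_sum_of_subset_of_nonneg hs fun i _ _ => hb0 i).trans hball
    have hsum2 : ∑ j ∈ Finset.Icc 1 A, cc j ≤
        (θ + 1 / ρ) * C + (1 / θ) * (C / (l * κ * r) + C / (l * κ * r)) := by
      have heq : ∑ j ∈ Finset.Icc 1 A, cc j = ∑ i ∈ Finset.Icc 1 A ×ˢ Finset.Ico 1 B,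
          stepCost Q ρ θ (w i) (w (i + (0, 1))) := by
        rw [Finset.sum_product]
        simp [hcc]
      rw [heq]
      simp only [stepCost]
      rw [Finset.sum_add_distrib, ← Finset.mul_sum, ← Finset.mul_sum, Finset.sum_add_distrib]
      have h1 : ∑ i ∈ Finset.Icc 1 A ×ˢ Finset.Ico 1 B, dist (w (i + (0, 1))) (w i) ^ 2 ≤ C :=
        (Finset.sum_le_sum_of_subset_of_nonneg
          (Finset.product_subset_product_right Finset.Ico_subset_Icc_self)
          fun i _ _ => by positivity).trans he4
      have h2 := hsub (Finset.Icc 1 A ×ˢ Finset.Ico 1 B) (Finset.product_subset_product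
        (Finset.Icc_subset_Icc_right (by omega)) Finset.Ico_subset_Icc_self)
      have h3 : ∑ i ∈ Finset.Icc 1 A ×ˢ Finset.Ico 1 B, b (i + (0, 1)) ≤ C / (l * κ * r) := by
        have := hsub ((Finset.Icc 1 A ×ˢ Finset.Ico 1 B).map (addRightEmbedding (0, 1)))
          fun i hi => by
            rw [Finset.mem_map] at hi
            obtain ⟨i, hi, rfl⟩ := hi
            simp only [Finset.mem_product, Finset.mem_Ico, Finset.mem_Icc,
              addRightEmbedding_apply, Prod.fst_add, Prod.snd_add] at hi ⊢
            omega
        rwa [Finset.sum_map] at this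
      gcongr
    rw [Finset.sum_add_distrib, ← Finset.sum_div] at hcard
    have hKey : l * D.card ≤ l * (2 * C / (κ * r) +
        ((θ + 1 / ρ) * C + (1 / θ) * (C / (l * κ * r) + C / (l * κ * r))) / ρ) := by
      gcongr
      refine hcard.trans ?_
      gcongr
    refine hKey.trans ?_
    have hss : √(l / r) * √(l / r) = l / r := Real.mul_self_sqrt (by positivity)
    have hinv : (1 / θ) / r = √(l / r) := by
      rw [hθ, one_div_div, div_div, div_eq_iff (by positivity)]
      field_simp
      rw [sq, hss]
      field_simp
    have hexp : l * (2 * C / (κ * r) +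
        ((θ + 1 / ρ) * C + (1 / θ) * (C / (l * κ * r) + C / (l * κ * r))) / ρ) =
        2 * C / κ * (l / r) + (C / ρ) * (l * θ) + C / ρ ^ 2 * l +
          2 * C / (ρ * κ) * ((1 / θ) / r) := by
      field_simp
      ring
    have hlθ : l * θ = √(l / r) := by rw [hθ]; field_simp
    rw [hexp, hinv, hlθ]
    have hε : 0 < l / r := by positivity
    have k1 : 0 ≤ 2 * C / κ := by positivity
    have k2 : 0 ≤ C / ρ := by positivity
    have k3 : 0 ≤ C / ρ ^ 2 := by positivity
    have k4 : 0 ≤ 2 * C / (ρ * κ) := by positivity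
    generalize √(l / r) = y at *
    generalize l / r = x at *
    generalize 2 * C / κ = K1 at *
    generalize C / ρ = K2 at *
    generalize C / ρ ^ 2 = K3 at *
    generalize 2 * C / (ρ * κ) = K4 at *
    have : (K1 + K2 + K3 + K4) * (x + y + l) - (K1 * x + K2 * y + K3 * l + K4 * y) =
      K1 * (y + l) + K2 * (x + l) + K3 * (x + y) + K4 * (x + l) := by ring
    have : 0 ≤ K1 * (y + l) + K2 * (x + l) + K3 * (x + y) + K4 * (x + l) := by positivity
    linarith
  · rintro ⟨j, m⟩ hi hjD p' hp' hd
    rw [Finset.mem_product] at hi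
    obtain ⟨hj, hm⟩ := hi
    simp only [hD, Finset.mem_filter, not_and, not_or] at hjD hj hm hd ⊢
    obtain ⟨hgood, hcost⟩ := hjD hj
    push Not at hgood hcost
    obtain ⟨p₀, hp₀, hd₀⟩ := hgood
    rw [hp j hj p₀ hp₀ hd₀]
    rw [Finset.mem_Icc] at hm hm₀
    have hpart : ∀ m m' : ℤ, 1 ≤ m → m' ≤ B →
        ∑ i ∈ Finset.Ico m m', stepCost Q ρ θ (w (j, i)) (w (j, i + 1)) < ρ := fun m m' h h' =>
      (Finset.sum_le_sum_of_subset_of_nonneg (Finset.Ico_subset_Ico h h')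
        fun i _ _ => stepCost_nonneg Q hρ hθ0 _ _).trans_lt hcost
    rcases le_total m₀ m with hle | hle
    · exact eq_of_sum_stepCost_lt hρ hθ0 hsep (f := fun i => w (j, i)) hle
        (hpart _ _ hm₀.1 hm.2) hp₀ hp' hd₀ hd
    · exact (eq_of_sum_stepCost_lt hρ hθ0 hsep (f := fun i => w (j, i)) hle
        (hpart _ _ hm.1 hm₀.2) hp' hp₀ hd hd₀).symm

/-! ### Integrals of functions that are constant on the cells of the lattice -/

/-- Only an inequality, since cells may stick out of `Ω`. The indices start at 0 because coordinates
in `(0, l)` have floor 0. -/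
theorem lintegral_floor_le {l : ℝ} (hl : 0 < l) {N : ℤ} (hN : 1 ≤ l * (N + 1))
    (g : ℤ × ℤ → ENNReal) :
    ∫⁻ x, g (⌊x.1 / l⌋, ⌊x.2 / l⌋) ∂muOmega ≤
      ∑ i ∈ Finset.Icc 0 N ×ˢ Finset.Icc 0 N, ENNReal.ofReal (l ^ 2) * g i := by
  set cell : ℤ × ℤ → Set (ℝ × ℝ) := fun i =>
    Set.Ico (l * i.1) (l * i.1 + l) ×ˢ Set.Ico (l * i.2) (l * i.2 + l) with hcell
  have hcm : ∀ i, MeasurableSet (cell i) := fun i => measurableSet_Ico.prod measurableSet_Ico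
  have hvol : ∀ i, volume (cell i) = ENNReal.ofReal (l ^ 2) := by
    intro i
    rw [hcell, Measure.volume_eq_prod, Measure.prod_prod, Real.volume_Ico, Real.volume_Ico,
      add_sub_cancel_left, add_sub_cancel_left, ← ENNReal.ofReal_mul hl.le, sq]
  have hfl : ∀ t ∈ Set.Ioo (0 : ℝ) 1, ⌊t / l⌋ ∈ Finset.Icc 0 N ∧
      t ∈ Set.Ico (l * (⌊t / l⌋ : ℝ)) (l * (⌊t / l⌋ : ℝ) + l) := by
    intro t ht
    have h1 := Int.floor_le (t / l)
    have h2 := Int.lt_floor_add_one (t / l)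
    rw [le_div_iff₀ hl] at h1
    rw [div_lt_iff₀ hl] at h2
    refine ⟨Finset.mem_Icc.2 ⟨Int.floor_nonneg.2 (div_nonneg ht.1.le hl.le), ?_⟩, ?_, ?_⟩
    · have h3 : (⌊t / l⌋ : ℝ) * l < (N + 1 : ℝ) * l := by linarith [ht.2]
      have h4 : ⌊t / l⌋ < N + 1 := by exact_mod_cast lt_of_mul_lt_mul_right h3 hl.le
      omega
    · linarith
    · linarith
  have hle : ∀ x ∈ Omega, g (⌊x.1 / l⌋, ⌊x.2 / l⌋) ≤
      ∑ i ∈ Finset.Icc 0 N ×ˢ Finset.Icc 0 N, (cell i).indicator (fun _ => g i) x := by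
    rintro ⟨x, y⟩ ⟨hx, hy⟩
    obtain ⟨hx1, hx2⟩ := hfl x hx
    obtain ⟨hy1, hy2⟩ := hfl y hy
    refine le_trans (le_of_eq ?_) (Finset.single_le_sum (f := fun i =>
      (cell i).indicator (fun _ => g i) (x, y)) (fun _ _ => zero_le)
      (Finset.mk_mem_product hx1 hy1))
    have hmem : (x, y) ∈ cell (⌊x / l⌋, ⌊y / l⌋) := Set.mk_mem_prod hx2 hy2
    exact (Set.indicator_of_mem hmem fun _ => g (⌊x / l⌋, ⌊y / l⌋)).symm
  calc _ ≤ ∫⁻ x, ∑ i ∈ Finset.Icc 0 N ×ˢ Finset.Icc 0 N,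
        (cell i).indicator (fun _ => g i) x ∂muOmega :=
        setLIntegral_mono' (measurableSet_Ioo.prod measurableSet_Ioo) hle
    _ ≤ ∫⁻ x, ∑ i ∈ Finset.Icc 0 N ×ˢ Finset.Icc 0 N,
        (cell i).indicator (fun _ => g i) x := lintegral_mono' Measure.restrict_le_self le_rfl
    _ = _ := by
        rw [lintegral_finsetSum _ fun i _ => measurable_const.indicator (hcm i)]
        refine Finset.sum_congr rfl fun i _ => ?_
        rw [lintegral_indicator_const (hcm i), hvol, mul_comm]

/-! ### Geometry of the index sets -/

/-- The largest index on each axis. -/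
noncomputable def maxIdx (l : ℝ) : ℤ := ⌈1 / l⌉ - 1

theorem one_le_mul_maxIdx_add_one {l : ℝ} (hl : 0 < l) : 1 ≤ l * (maxIdx l + 1) := by
  have := Int.le_ceil (1 / l)
  rw [div_le_iff₀ hl] at this
  simp only [maxIdx, Int.cast_sub, Int.cast_one]
  linarith

theorem mul_maxIdx_lt_one {l : ℝ} (hl : 0 < l) : l * maxIdx l < 1 := by
  have := Int.ceil_lt_add_one (1 / l)
  have h : (maxIdx l : ℝ) < 1 / l := by
    simp only [maxIdx, Int.cast_sub, Int.cast_one]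
    linarith
  rw [lt_div_iff₀ hl] at h
  linarith

theorem mem_idx2_iff {l : ℝ} {i : ℤ × ℤ} :
    i ∈ idx2 l ↔ 1 ≤ i.1 ∧ i.1 ≤ maxIdx l ∧ 1 ≤ i.2 ∧ i.2 ≤ maxIdx l := by
  simp only [idx2, idx, maxIdx, Finset.mem_product, Finset.mem_Ioo]
  omega

theorem stencilIdx_eq (l : ℝ) :
    stencilIdx l = Finset.Icc 1 (maxIdx l - 2) ×ˢ Finset.Icc 1 (maxIdx l - 1) := by
  ext i
  simp only [stencilIdx, Finset.mem_filter, mem_idx2_iff, Finset.mem_product, Finset.mem_Icc,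
    Prod.fst_add, Prod.snd_add]
  omega

theorem exists_separation {Q : Set E3} (hQ : Q.Finite) :
    ∃ ρ > 0, ρ ≤ 1 ∧ ∀ p ∈ Q, ∀ p' ∈ Q, p ≠ p' → 4 * ρ ≤ dist p p' := by
  rcases Q.subsingleton_or_nontrivial with h | h
  · exact ⟨1, one_pos, le_rfl, fun p hp p' hp' hne => absurd (h hp hp') hne⟩
  · have h0 : 0 < Q.infsep := hQ.infsep_pos_iff_nontrivial.2 h
    refine ⟨min 1 (Q.infsep / 4), by positivity, min_le_left _ _, fun p hp p' hp' hne => ?_⟩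
    have h1 := Set.infsep_le_dist_of_mem hp hp' hne
    have h2 := min_le_right 1 (Q.infsep / 4)
    linarith

/-! ### Consequences of the energy bound -/

/-- The density at a lattice site. -/
noncomputable def siteDensity (d : ℝ) (G : E3 → ℝ) (u : ℤ × ℤ → E3) (i : ℤ × ℤ) : ℝ :=
  density d G (u i) (u (i + (1, 0))) (u (i + (2, 0)))

/-- The rescaled chirality at a lattice site. -/
noncomputable def siteChi (d : ℝ) (u : ℤ × ℤ → E3) (i : ℤ × ℤ) : E3 :=
  chi d (u i) (u (i + (1, 0)))

theorem sum_siteDensity_add_le {l d J : ℝ} {G : E3 → ℝ} {u : ℤ × ℤ → E3} (hG : ∀ x, 0 ≤ G x) :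
    ∑ i ∈ stencilIdx l, l ^ 2 * siteDensity d G u i +
      J * ∑ i ∈ stencilIdx l, l ^ 2 * ‖u (i + (0, 1)) - u i‖ ^ 2 ≤
      2 * (energyH l d J u + energyP l d G u) := by
  have h : ∑ i ∈ stencilIdx l, l ^ 2 * siteDensity d G u i =
      ∑ i ∈ stencilIdx l, l ^ 2 * ‖u i - (2 * (1 - d)) • u (i + (1, 0)) + u (i + (2, 0))‖ ^ 2 +
        d ^ 2 * ∑ i ∈ stencilIdx l, l ^ 2 * G (cross (u i) (u (i + (1, 0)))) := by
    rw [Finset.mul_sum, ← Finset.sum_add_distrib]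
    refine Finset.sum_congr rfl fun i _ => ?_
    rw [siteDensity, density]
    ring
  have h0 : 0 ≤ d ^ 2 * ∑ i ∈ stencilIdx l, l ^ 2 * G (cross (u i) (u (i + (1, 0)))) :=
    mul_nonneg (sq_nonneg d) (Finset.sum_nonneg fun i _ => mul_nonneg (sq_nonneg l) (hG _))
  rw [h, energyH, energyP]
  linarith

theorem density_nonneg {d : ℝ} {G : E3 → ℝ} (hG : ∀ x, 0 ≤ G x) (a b c : E3) :
    0 ≤ density d G a b c := by
  have := hG (cross a b)
  unfold density
  positivity

/-! ### Approximation by step functions of the first variable -/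

/-- On the inner cells `f ≤ 4 + e/r⁴`. The 4 is improved to `η` at good sites, charged to the area
`K` of the columns in `D`, or charged to `4e/(κr⁴)` at far sites; summed with weight `l²`, the terms
in `e` give a multiple of `C l/r`. The at most `6(N+1)` boundary cells carry at most `2/r` each. -/
theorem sum_cells_le {l r η κ K C : ℝ} (hl : 0 < l) (hr : 0 < r) (hη : 0 < η)
    (hκ : 0 < κ) {N : ℤ} (hN3 : 3 ≤ N) (hN : l * N ≤ 1) (hN' : l * (N + 1) ≤ 2)
    {f e : ℤ × ℤ → ℝ} {D : Finset ℤ} (hD : l * D.card ≤ K)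
    (he0 : ∀ i ∈ Finset.Icc 1 (N - 2) ×ˢ Finset.Icc 1 (N - 1), 0 ≤ e i)
    (he : ∑ i ∈ Finset.Icc 1 (N - 2) ×ˢ Finset.Icc 1 (N - 1), l * e i ≤ C * r ^ 3)
    (hf : ∀ i, f i ≤ 2 / r)
    (hf1 : ∀ i ∈ Finset.Icc 1 (N - 3) ×ˢ Finset.Icc 1 (N - 1), f i ≤ 4 + e i / r ^ 4)
    (hf2 : ∀ i ∈ Finset.Icc 1 (N - 3) ×ˢ Finset.Icc 1 (N - 1), i.1 ∉ D →
      f i < η ∨ κ * r ^ 4 ≤ e i) :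
    ∑ i ∈ Finset.Icc 0 N ×ˢ Finset.Icc 0 N, l ^ 2 * f i ≤
      η + 4 * K + (4 / κ + 1) * C * (l / r) + 24 * (l / r) := by
  classical
  set S : Finset (ℤ × ℤ) := Finset.Icc 1 (N - 3) ×ˢ Finset.Icc 1 (N - 1) with hS
  set R : Finset (ℤ × ℤ) := Finset.Icc 1 (N - 2) ×ˢ Finset.Icc 1 (N - 1) with hR
  have hSR : S ⊆ R := Finset.product_subset_product (Finset.Icc_subset_Icc_right (by omega)) le_rfl
  have hSF : S ⊆ Finset.Icc 0 N ×ˢ Finset.Icc 0 N := Finset.product_subset_product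
    (Finset.Icc_subset_Icc (by omega) (by omega)) (Finset.Icc_subset_Icc (by omega) (by omega))
  have hNR : (3 : ℝ) ≤ N := by exact_mod_cast hN3
  have hcast : ∀ a b : ℤ, a ≤ b + 1 → ((Finset.Icc a b).card : ℝ) = b + 1 - a := by
    intro a b h
    rw [Int.card_Icc]
    have : (((b + 1 - a).toNat : ℤ) : ℝ) = ((b + 1 - a : ℤ) : ℝ) := by
      rw [Int.toNat_of_nonneg (by omega)]
    push_cast at this
    rw [← this]
  have hcS : (S.card : ℝ) = (N - 3) * (N - 1) := by
    rw [hS, Finset.card_product, Nat.cast_mul, hcast _ _ (by omega), hcast _ _ (by omega)]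
    push_cast
    ring_nf
  have hcF : (((Finset.Icc 0 N ×ˢ Finset.Icc 0 N) \ S).card : ℝ) ≤ 6 * (N + 1) := by
    rw [Finset.cast_card_sdiff hSF, hcS, Finset.card_product, Nat.cast_mul,
      hcast _ _ (by omega)]
    push_cast
    linarith
  rw [← Finset.sum_sdiff hSF]
  have hout : ∑ i ∈ (Finset.Icc 0 N ×ˢ Finset.Icc 0 N) \ S, l ^ 2 * f i ≤ 24 * (l / r) := by
    calc _ ≤ ∑ i ∈ (Finset.Icc 0 N ×ˢ Finset.Icc 0 N) \ S, l ^ 2 * (2 / r) :=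
          Finset.sum_le_sum fun i _ => mul_le_mul_of_nonneg_left (hf i) (by positivity)
      _ = (((Finset.Icc 0 N ×ˢ Finset.Icc 0 N) \ S).card : ℝ) * (l ^ 2 * (2 / r)) := by
          rw [Finset.sum_const, nsmul_eq_mul]
      _ ≤ 6 * (N + 1) * (l ^ 2 * (2 / r)) := by gcongr
      _ = l * (N + 1) * (12 * (l / r)) := by ring
      _ ≤ 2 * (12 * (l / r)) := by gcongr
      _ = _ := by ring
  have hin : ∑ i ∈ S, l ^ 2 * f i ≤ η + 4 * K + (4 / κ + 1) * C * (l / r) := by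
    have hterm : ∀ i ∈ S, l ^ 2 * f i ≤ l ^ 2 * η + 4 * l ^ 2 * (if i.1 ∈ D then 1 else 0) +
        (4 / κ + 1) * l / r ^ 4 * (l * e i) := by
      intro i hi
      have h0 := he0 i (hSR hi)
      have hb : f i ≤ η + 4 * (if i.1 ∈ D then 1 else 0) + (4 / κ + 1) / r ^ 4 * e i := by
        have h1 := hf1 i hi
        have heq : (4 / κ + 1) / r ^ 4 * e i = 4 * (e i / (κ * r ^ 4)) + e i / r ^ 4 := by
          field_simp
        have h3 : 0 ≤ e i / r ^ 4 := by positivity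
        have h4 : 0 ≤ e i / (κ * r ^ 4) := by positivity
        rw [heq]
        split_ifs with hiD
        · linarith
        · rcases hf2 i hi hiD with h | h
          · linarith
          · have : 1 ≤ e i / (κ * r ^ 4) := (one_le_div (by positivity)).2 h
            linarith
      calc l ^ 2 * f i ≤ l ^ 2 * (η + 4 * (if i.1 ∈ D then 1 else 0) +
            (4 / κ + 1) / r ^ 4 * e i) := by gcongr
        _ = _ := by ring
    refine (Finset.sum_le_sum hterm).trans ?_
    rw [Finset.sum_add_distrib, Finset.sum_add_distrib, Finset.sum_const, nsmul_eq_mul,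
      ← Finset.mul_sum (a := 4 * l ^ 2), ← Finset.mul_sum (a := (4 / κ + 1) * l / r ^ 4)]
    have h1 : (S.card : ℝ) * (l ^ 2 * η) ≤ η := by
      have : (S.card : ℝ) * (l ^ 2 * η) = (l * (N - 3)) * (l * (N - 1)) * η := by rw [hcS]; ring
      rw [this]
      refine mul_le_of_le_one_left hη.le (mul_le_one₀ ?_ ?_ ?_) <;> nlinarith
    have h2 : ∑ i ∈ S, (if i.1 ∈ D then (1 : ℝ) else 0) ≤ D.card * (N - 1) := by
      have hsub : S.filter (fun i => i.1 ∈ D) ⊆ D ×ˢ Finset.Icc 1 (N - 1) := fun i hi => by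
        rw [Finset.mem_filter] at hi
        exact Finset.mem_product.2 ⟨hi.2, (Finset.mem_product.1 hi.1).2⟩
      have hcard : (N : ℝ) - 1 = ((Finset.Icc 1 (N - 1)).card : ℝ) := by
        rw [hcast _ _ (by omega)]
        push_cast
        ring
      rw [Finset.sum_boole, hcard, ← Nat.cast_mul, ← Finset.card_product]
      exact_mod_cast Finset.card_le_card hsub
    have h3 : ∑ i ∈ S, l * e i ≤ C * r ^ 3 :=
      (Finset.sum_le_sum_of_subset_of_nonneg hSR fun i hi _ => mul_nonneg hl.le (he0 i hi)).trans he
    have h4 : 4 * l ^ 2 * ∑ i ∈ S, (if i.1 ∈ D then (1 : ℝ) else 0) ≤ 4 * K := by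
      calc _ ≤ 4 * l ^ 2 * (D.card * (N - 1)) := by gcongr
        _ = 4 * (l * D.card) * (l * (N - 1)) := by ring
        _ ≤ 4 * (l * D.card) * 1 := by gcongr; nlinarith
        _ ≤ _ := by linarith
    have h5 : (4 / κ + 1) * l / r ^ 4 * ∑ i ∈ S, l * e i ≤ (4 / κ + 1) * C * (l / r) := by
      calc _ ≤ (4 / κ + 1) * l / r ^ 4 * (C * r ^ 3) := by gcongr
        _ = _ := by field_simp
    linarith
  linarith

/-- The sites at which the energy density of a spin field is controlled. -/
noncomputable def rect (l : ℝ) : Finset (ℤ × ℤ) :=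
  Finset.Icc 1 (maxIdx l - 2) ×ˢ Finset.Icc 1 (maxIdx l - 1)

theorem IsSpinField.norm_eq_one {l : ℝ} {u : ℤ × ℤ → E3} (hu : IsSpinField l u) {i : ℤ × ℤ}
    (hi : i ∈ rect l) : ‖u i‖ = 1 ∧ ‖u (i + (1, 0))‖ = 1 ∧ ‖u (i + (2, 0))‖ = 1 ∧
      ‖u (i + (0, 1))‖ = 1 := by
  simp only [rect, Finset.mem_product, Finset.mem_Icc] at hi
  refine ⟨hu.1 _ ?_, hu.1 _ ?_, hu.1 _ ?_, hu.1 _ ?_⟩ <;>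
    simp only [mem_idx2_iff, Prod.fst_add, Prod.snd_add] <;> omega

theorem siteDensity_nonneg {d : ℝ} {G : E3 → ℝ} (hG : ∀ x, 0 ≤ G x) (u : ℤ × ℤ → E3)
    (i : ℤ × ℤ) : 0 ≤ siteDensity d G u i := density_nonneg hG _ _ _

/-- The hypothesis on `J` says `J l² ≥ c l r`; dividing the energy bound, of order `l r³`, by this
leaves `r²/c` for the vertical differences. -/
theorem sum_siteDensity_le {l r J c C : ℝ} (hl : 0 < l) (hr : 0 < r) (hc : 0 < c)
    (hJ : c ≤ J * (l / r)) {G : E3 → ℝ} (hG : ∀ x, 0 ≤ G x) {u : ℤ × ℤ → E3}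
    (hE : energyH l (r ^ 2) J u + energyP l (r ^ 2) G u ≤ C * l * r ^ 3) :
    ∑ i ∈ rect l, l * siteDensity (r ^ 2) G u i ≤ 2 * C * r ^ 3 ∧
      ∑ i ∈ rect l, ‖u (i + (0, 1)) - u i‖ ^ 2 ≤ 2 * C / c * r ^ 2 := by
  have hJ0 : 0 < J := by
    have : 0 < J * (l / r) := hc.trans_le hJ
    exact pos_of_mul_pos_left this (by positivity)
  have hsum := sum_siteDensity_add_le (l := l) (d := r ^ 2) (J := J) (u := u) hG
  rw [stencilIdx_eq, ← rect, ← Finset.mul_sum, ← Finset.mul_sum] at hsum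
  rw [← Finset.mul_sum]
  have he0 : 0 ≤ ∑ i ∈ rect l, siteDensity (r ^ 2) G u i :=
    Finset.sum_nonneg fun i _ => siteDensity_nonneg hG u i
  have hs0 : 0 ≤ ∑ i ∈ rect l, ‖u (i + (0, 1)) - u i‖ ^ 2 :=
    Finset.sum_nonneg fun i _ => by positivity
  set e := ∑ i ∈ rect l, siteDensity (r ^ 2) G u i
  set s := ∑ i ∈ rect l, ‖u (i + (0, 1)) - u i‖ ^ 2
  constructor
  · have h0 : 0 ≤ J * (l ^ 2 * s) := by positivity
    have h2 : l * (l * e) ≤ l * (2 * C * r ^ 3) := by linarith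
    exact le_of_mul_le_mul_left h2 hl
  · have h0 : 0 ≤ l ^ 2 * e := by positivity
    have h1 : J * (l ^ 2 * s) ≤ 2 * (C * l * r ^ 3) := by linarith
    have h2 : c * s * (l * r) ≤ J * (l / r) * s * (l * r) := by gcongr
    have h3 : J * (l / r) * s * (l * r) = J * (l ^ 2 * s) := by field_simp
    have h4 : c * s * (l * r) ≤ 2 * C * r ^ 2 * (l * r) := by linarith
    have h5 := le_of_mul_le_mul_right h4 (by positivity)
    rw [div_mul_eq_mul_div, le_div_iff₀ hc]
    linarith

theorem add_e1_add_e1 (i : ℤ × ℤ) : i + (1, 0) + (1, 0) = i + (2, 0) := by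
  rw [add_assoc]; rfl

theorem sum_dist_siteChi_le {l r K : ℝ} (hr : 0 < r) {u : ℤ × ℤ → E3} (hu : IsSpinField l u)
    (hK : ∑ i ∈ rect l, ‖u (i + (0, 1)) - u i‖ ^ 2 ≤ K * r ^ 2) :
    ∑ i ∈ Finset.Icc 1 (maxIdx l - 3) ×ˢ Finset.Icc 1 (maxIdx l - 1),
      dist (siteChi (r ^ 2) u (i + (0, 1))) (siteChi (r ^ 2) u i) ^ 2 ≤ 2 * K := by
  have hr2 : 0 < r ^ 2 := by positivity
  set N := maxIdx l with hN
  have hSR : Finset.Icc 1 (N - 3) ×ˢ Finset.Icc 1 (N - 1) ⊆ rect l :=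
    Finset.product_subset_product (Finset.Icc_subset_Icc_right (by omega)) le_rfl
  -- The chirality at `i` also involves `u` at `i + e₁`. The rectangle shifted by `e₁` must stay in
  -- `rect l`, hence one column fewer.
  have hSR' : (Finset.Icc 1 (N - 3) ×ˢ Finset.Icc 1 (N - 1)).map (addRightEmbedding (1, 0)) ⊆
      rect l := by
    intro i hi
    rw [Finset.mem_map] at hi
    obtain ⟨i, hi, rfl⟩ := hi
    simp only [rect, Finset.mem_product, Finset.mem_Icc, addRightEmbedding_apply, Prod.fst_add,
      Prod.snd_add] at hi ⊢
    omega
  have hterm : ∀ i ∈ Finset.Icc 1 (N - 3) ×ˢ Finset.Icc 1 (N - 1),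
      dist (siteChi (r ^ 2) u (i + (0, 1))) (siteChi (r ^ 2) u i) ^ 2 ≤
        (‖u (i + (0, 1)) - u i‖ ^ 2 +
          ‖u (i + (1, 0) + (0, 1)) - u (i + (1, 0))‖ ^ 2) / r ^ 2 := by
    intro i hi
    have hi' : i + (1, 0) ∈ rect l := hSR' (Finset.mem_map.2 ⟨i, hi, rfl⟩)
    have h1 := norm_chi_sub_chi_sq_le hr2 (hu.norm_eq_one (hSR hi)).1
      (hu.norm_eq_one hi').2.2.2 (a' := u (i + (0, 1))) (b := u (i + (1, 0)))
    rw [le_div_iff₀ hr2, dist_eq_norm, mul_comm, siteChi, siteChi,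
      add_right_comm i (0, 1) (1, 0)]
    exact h1
  refine (Finset.sum_le_sum hterm).trans ?_
  rw [← Finset.sum_div, Finset.sum_add_distrib, div_le_iff₀ hr2]
  have h1 := (Finset.sum_le_sum_of_subset_of_nonneg hSR
    (f := fun i => ‖u (i + (0, 1)) - u i‖ ^ 2) fun i _ _ => by positivity).trans hK
  have h2 := (Finset.sum_le_sum_of_subset_of_nonneg hSR'
    (f := fun i => ‖u (i + (0, 1)) - u i‖ ^ 2) fun i _ _ => by positivity).trans hK
  rw [Finset.sum_map] at h2
  simp only [addRightEmbedding_apply] at h2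
  linarith

theorem three_le_maxIdx {l : ℝ} (hl : 0 < l) (hl8 : l ≤ 1 / 8) : 3 ≤ maxIdx l := by
  have hN1 := one_le_mul_maxIdx_add_one hl
  by_contra hcon
  have : (maxIdx l : ℝ) + 1 ≤ 3 := by exact_mod_cast (by omega : maxIdx l + 1 ≤ 3)
  nlinarith

/-- If the phases are given by `p (S j)` outside of few columns, then the chirality is close in
`L¹` to a step function. -/
theorem lintegral_chirality_sub_le {Q : Set E3} (hQ : ∀ p ∈ Q, ‖p‖ = 1) {G : E3 → ℝ}
    (hG : ∀ x, 0 ≤ G x) {l r K C ρ : ℝ} (hl : 0 < l) (hl8 : l ≤ 1 / 8) (hr : 0 < r) (hr1 : r ≤ 1)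
    {u : ℤ × ℤ → E3} (hu : IsSpinField l u)
    (he : ∑ i ∈ rect l, l * siteDensity (r ^ 2) G u i ≤ C * r ^ 3) {S : ℤ → ℕ} {p : ℕ → E3}
    (hp : ∀ s, p s ∈ Q) {D : Finset ℤ} (hD : l * D.card ≤ K)
    (hphase : ∀ i ∈ Finset.Icc 1 (maxIdx l - 3) ×ˢ Finset.Icc 1 (maxIdx l - 1), i.1 ∉ D →
      ∀ p' ∈ Q, dist (siteChi (r ^ 2) u i) p' < ρ → p (S i.1) = p')
    {η κ : ℝ} (hη : 0 < η) (hηρ : η ≤ ρ) (hκ : 0 < κ)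
    (hcoer : ∀ a b c : E3, ‖a‖ = 1 → ‖b‖ = 1 → ‖c‖ = 1 →
      (∀ p ∈ Q, η ≤ dist (chi (r ^ 2) a b) p) → κ * (r ^ 2) ^ 2 ≤ density (r ^ 2) G a b c) :
    ∫⁻ x, ‖chirality l (r ^ 2) u x - p (S ⌊x.1 / l⌋)‖ₑ ∂muOmega ≤
      ENNReal.ofReal (η + 4 * K + (4 / κ + 1) * C * (l / r) + 24 * (l / r)) := by
  classical
  have hr2 : 0 < r ^ 2 := by positivity
  have hN1 := one_le_mul_maxIdx_add_one hl
  have hN2 := mul_maxIdx_lt_one hl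
  have hN3 := three_le_maxIdx hl hl8
  have hr4 : (r ^ 2) ^ 2 = r ^ 4 := by ring
  have hpn : ∀ s, ‖p s‖ = 1 := fun s => hQ _ (hp s)
  set w : ℤ × ℤ → E3 := siteChi (r ^ 2) u with hw
  set f : ℤ × ℤ → ℝ := fun i =>
    ‖(if i ∈ idx2 l ∧ i + (1, 0) ∈ idx2 l then w i else 0) - p (S i.1)‖ with hf
  have hchi : ∀ x : ℝ × ℝ, ‖chirality l (r ^ 2) u x - p (S ⌊x.1 / l⌋)‖ₑ =
      ENNReal.ofReal (f (⌊x.1 / l⌋, ⌊x.2 / l⌋)) := by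
    intro x
    rw [hf, ofReal_norm]
    rfl
  have hinside : ∀ i ∈ Finset.Icc 1 (maxIdx l - 3) ×ˢ Finset.Icc 1 (maxIdx l - 1),
      i ∈ rect l ∧ f i = ‖w i - p (S i.1)‖ := by
    intro i hi
    simp only [Finset.mem_product, Finset.mem_Icc] at hi
    constructor
    · simp only [rect, Finset.mem_product, Finset.mem_Icc]
      omega
    · have : i ∈ idx2 l ∧ i + (1, 0) ∈ idx2 l := by
        simp only [mem_idx2_iff, Prod.fst_add, Prod.snd_add]
        omega
      simp only [hf, if_pos this]
  have hf0 : ∀ i, f i ≤ 2 / r := by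
    intro i
    have h1 : ‖(if i ∈ idx2 l ∧ i + (1, 0) ∈ idx2 l then w i else 0)‖ ≤ 1 / r := by
      split_ifs with h
      · refine (norm_chi_le (hu.1 _ h.1) (hu.1 _ h.2)).trans ?_
        refine one_div_le_one_div_of_le hr (Real.le_sqrt_of_sq_le ?_)
        linarith
      · rw [norm_zero]; positivity
    have h2 : 1 ≤ 1 / r := (one_le_div hr).2 hr1
    have h3 := norm_sub_le (if i ∈ idx2 l ∧ i + (1, 0) ∈ idx2 l then w i else 0) (p (S i.1))
    have h4 : (2 : ℝ) / r = 1 / r + 1 / r := by ring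
    rw [hpn] at h3
    rw [h4]
    exact h3.trans (by linarith)
  have hf1 : ∀ i ∈ Finset.Icc 1 (maxIdx l - 3) ×ˢ Finset.Icc 1 (maxIdx l - 1),
      f i ≤ 4 + siteDensity (r ^ 2) G u i / r ^ 4 := by
    intro i hi
    obtain ⟨hiR, hfi⟩ := hinside i hi
    obtain ⟨h1, h2, h3, -⟩ := hu.norm_eq_one hiR
    have h4 : ‖w i‖ ≤ 3 + siteDensity (r ^ 2) G u i / (r ^ 2) ^ 2 :=
      norm_chi_le_density hr2 hG h1 h2 h3
    have h5 := norm_sub_le (w i) (p (S i.1))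
    rw [hpn] at h5
    rw [hr4] at h4
    rw [hfi]
    linarith
  have hf2 : ∀ i ∈ Finset.Icc 1 (maxIdx l - 3) ×ˢ Finset.Icc 1 (maxIdx l - 1), i.1 ∉ D →
      f i < η ∨ κ * r ^ 4 ≤ siteDensity (r ^ 2) G u i := by
    intro i hi hiD
    obtain ⟨hiR, hfi⟩ := hinside i hi
    by_cases hfar : ∀ p ∈ Q, η ≤ dist (w i) p
    · right
      rw [← hr4]
      obtain ⟨h1, h2, h3, -⟩ := hu.norm_eq_one hiR
      exact hcoer _ _ _ h1 h2 h3 hfar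
    · left
      push Not at hfar
      obtain ⟨p', hp', hd⟩ := hfar
      rw [hfi, hphase i hi hiD p' hp' (hd.trans_le hηρ), ← dist_eq_norm]
      exact hd
  have hcells := sum_cells_le hl hr hη hκ hN3 hN2.le (by linarith) hD
    (fun i _ => siteDensity_nonneg hG u i) he hf0 hf1 hf2
  simp_rw [hchi]
  refine (lintegral_floor_le hl hN1 fun i => ENNReal.ofReal (f i)).trans ?_
  have hl2 : (0 : ℝ) ≤ l ^ 2 := by positivity
  simp_rw [← ENNReal.ofReal_mul hl2]
  rw [← ENNReal.ofReal_sum_of_nonneg fun i _ => mul_nonneg hl2 (norm_nonneg _)]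
  exact ENNReal.ofReal_le_ofReal hcells

/-- The order of the quantifiers matters: `S` and `p` are built once, from the separation radius
`ρ`, and the accuracy `η ≤ ρ` comes afterwards with its own coercivity constant `κ`. The same step
function thus serves every `η`. -/
theorem exists_step_approx {k : ℕ} (hk : 1 ≤ k) {q : Fin k → E3} (hq : ∀ j, ‖q j‖ = 1)
    {G : E3 → ℝ} (hG : IsPenalty q G) {c C : ℝ} (hc : 0 < c) (hC : 0 ≤ C) :
    ∃ M : ℕ, ∃ K : ℝ, 0 ≤ K ∧ ∃ ρ > 0, ∃ r₀ > 0, ∀ l r J : ℝ, 0 < l → l ≤ 1 / 8 → 0 < r →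
      r ≤ r₀ → c ≤ J * (l / r) → ∀ u : ℤ × ℤ → E3, IsSpinField l u →
      energyH l (r ^ 2) J u + energyP l (r ^ 2) G u ≤ C * l * r ^ 3 →
      ∃ S : ℤ → ℕ, Monotone S ∧ (∀ j, S j ≤ M) ∧ ∃ p : ℕ → E3, (∀ s, p s ∈ wells q) ∧
        ∀ η κ, 0 < η → η ≤ ρ → 0 < κ →
          (∀ a b c : E3, ‖a‖ = 1 → ‖b‖ = 1 → ‖c‖ = 1 →
            (∀ p ∈ wells q, η ≤ dist (chi (r ^ 2) a b) p) →
              κ * (r ^ 2) ^ 2 ≤ density (r ^ 2) G a b c) →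
          ∫⁻ x, ‖chirality l (r ^ 2) u x - p (S ⌊x.1 / l⌋)‖ₑ ∂muOmega ≤
            ENNReal.ofReal (η + K * (l / r + √(l / r) + l) + K / κ * (l / r)) := by
  obtain ⟨ρ, hρ, hρ1, hsep⟩ := exists_separation (finite_wells q)
  obtain ⟨κ₀, hκ₀, d₀, hd₀, hcoer⟩ := hG.density_coercive hq hρ hρ1
  have hQne : (wells q).Nonempty := ⟨q ⟨0, hk⟩, ⟨0, hk⟩, Or.inl rfl⟩
  have hCc : 0 ≤ 2 * (2 * C / c) := by positivity
  obtain ⟨C₁, hC₁0, hC₁, hC₁'⟩ : ∃ C₁, 0 ≤ C₁ ∧ 2 * C ≤ C₁ ∧ 2 * (2 * C / c) ≤ C₁ :=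
    ⟨2 * C + 2 * (2 * C / c), by positivity, by linarith, by linarith⟩
  obtain ⟨M, K, hK, hmain⟩ := exists_phase_columns hQne hρ hsep hκ₀ hC₁0
  refine ⟨M, 4 * K + 4 * C₁ + C₁ + 24, by positivity, ρ, hρ, min 1 (√d₀), by positivity, ?_⟩
  intro l r J hl hl8 hr hr0 hJ u hu hE
  have hr1 : r ≤ 1 := hr0.trans (min_le_left _ _)
  have hrd : r ^ 2 ≤ d₀ := by
    rw [← Real.sq_sqrt hd₀.le]
    exact pow_le_pow_left₀ hr.le (hr0.trans (min_le_right _ _)) 2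
  have hr2 : 0 < r ^ 2 := by positivity
  have hr4 : (r ^ 2) ^ 2 = r ^ 4 := by ring
  have hN1 := one_le_mul_maxIdx_add_one hl
  obtain ⟨hesum, hdsum⟩ := sum_siteDensity_le hl hr hc hJ hG.nonneg hE
  have hesum' : ∑ i ∈ rect l, l * siteDensity (r ^ 2) G u i ≤ C₁ * r ^ 3 :=
    hesum.trans (mul_le_mul_of_nonneg_right hC₁ (by positivity))
  have hvert := (sum_dist_siteChi_le hr hu hdsum).trans hC₁'
  have hA : maxIdx l - 3 + 1 = maxIdx l - 2 := by ring
  have h := hmain l r hl hr hr1 (maxIdx l - 3) (maxIdx l - 1) (by push_cast; linarith)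
    (siteChi (r ^ 2) u) (siteDensity (r ^ 2) G u)
  rw [hA, ← rect] at h
  obtain ⟨S, hSmono, hSM, p, hpQ, D, hD, hphase⟩ := h
    (fun i _ => siteDensity_nonneg hG.nonneg u i)
    (fun i hi => by
      rw [siteDensity, density_eq hr2 G (hu.norm_eq_one hi).2.1, siteChi, siteChi, dist_eq_norm,
        add_e1_add_e1]
      have h1 : 0 ≤ (r ^ 2) ^ 2 * G (cross (u i) (u (i + (1, 0)))) :=
        mul_nonneg (sq_nonneg _) (hG.nonneg _)
      have h2 : 0 ≤ (r ^ 2) ^ 2 * ((1 - inner ℝ (u i) (u (i + (1, 0)))) / r ^ 2 +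
        (1 - inner ℝ (u (i + (1, 0))) (u (i + (2, 0)))) / r ^ 2 - 2) ^ 2 := by positivity
      linarith)
    (fun i hi hfar => by
      rw [← hr4]
      obtain ⟨h1, h2, h3, -⟩ := hu.norm_eq_one hi
      exact hcoer _ hr2 hrd _ _ _ h1 h2 h3 hfar)
    hesum' hvert
  refine ⟨S, hSmono, hSM, p, hpQ, fun η κ hη hηρ hκ hcoerη => ?_⟩
  refine (lintegral_chirality_sub_le (fun p hp => norm_of_mem_wells hq hp) hG.nonneg hl hl8 hr hr1
    hu hesum' hpQ hD hphase hη hηρ hκ hcoerη).trans (ENNReal.ofReal_le_ofReal ?_)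
  have hx : 0 < l / r := by positivity
  have hy : 0 ≤ √(l / r) := Real.sqrt_nonneg _
  have hsplit : (4 / κ + 1) * C₁ * (l / r) = 4 * C₁ / κ * (l / r) + C₁ * (l / r) := by
    field_simp
  have hKκ : (4 * K + 4 * C₁ + C₁ + 24) / κ * (l / r) =
      4 * C₁ / κ * (l / r) + (4 * K + C₁ + 24) / κ * (l / r) := by
    field_simp
    ring
  rw [hsplit, hKκ]
  have h1 : 0 ≤ (4 * K + C₁ + 24) / κ * (l / r) := by positivity
  have h2 : 0 ≤ (4 * C₁ + C₁ + 24) * (√(l / r) + l) := by positivity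
  have h3 : 0 ≤ 4 * C₁ * (l / r) := by positivity
  linarith

/-! ### Step functions of one variable -/

/-- The step function with value `c` near `-∞` and jumps `d s` at the points `a s`. -/
noncomputable def stepFun {M : ℕ} (c : E3) (a : Fin M → ℝ) (d : Fin M → E3) (x : ℝ) : E3 :=
  c + ∑ s, if a s ≤ x then d s else 0

/-- Telescoping along the levels of `S`, with `a s` the point where `S` first exceeds `s`. At `a s`
itself the level may or may not be reached, so these points are excluded. -/
theorem exists_stepFun_eq {S : ℝ → ℕ} (hS : Monotone S) {M : ℕ} (hSM : ∀ x, S x ≤ M)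
    (p : ℕ → E3) :
    ∃ a : Fin M → ℝ, (∀ s, a s ∈ Set.Icc (0 : ℝ) 1) ∧ ∀ x ∈ Set.Ioo (0 : ℝ) 1, (∀ s, x ≠ a s) →
      p (S x) = stepFun (p 0) a (fun s => p (s + 1) - p s) x := by
  -- Adjoining 1 puts the jump of a level that is never reached at 1, outside the open interval.
  set T : ℕ → Set ℝ := fun s => insert 1 {x | x ∈ Set.Icc (0 : ℝ) 1 ∧ s + 1 ≤ S x} with hT
  have hT0 : ∀ s, ∀ x ∈ T s, (0 : ℝ) ≤ x := by
    rintro s x (rfl | hx)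
    · exact zero_le_one
    · exact hx.1.1
  have hTb : ∀ s, BddBelow (T s) := fun s => ⟨0, fun x hx => hT0 s x hx⟩
  refine ⟨fun s => sInf (T s), fun s => ⟨le_csInf ⟨1, Set.mem_insert _ _⟩ (hT0 s),
    csInf_le (hTb s) (Set.mem_insert _ _)⟩, fun x hx hne => ?_⟩
  have hiff : ∀ s : Fin M, sInf (T s) ≤ x ↔ (s : ℕ) < S x := by
    intro s
    constructor
    · intro h
      obtain ⟨y, hy, hyx⟩ := exists_lt_of_csInf_lt ⟨1, Set.mem_insert _ _⟩
        (lt_of_le_of_ne h (hne s).symm)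
      rcases hy with rfl | hy
      · exact absurd hyx (not_lt.2 hx.2.le)
      · exact hy.2.trans (hS hyx.le)
    · intro h
      exact csInf_le (hTb s) (Set.mem_insert_of_mem _ ⟨⟨hx.1.le, hx.2.le⟩, h⟩)
  have hsum : ∑ s : Fin M, (if sInf (T s) ≤ x then p (s + 1) - p s else 0) =
      ∑ s ∈ Finset.range (S x), (p (s + 1) - p s) := by
    simp only [hiff]
    rw [Fin.sum_univ_eq_sum_range (fun s => if s < S x then p (s + 1) - p s else 0) M,
      ← Finset.sum_filter]
    congr 1
    ext s
    have := hSM x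
    simp only [Finset.mem_filter, Finset.mem_range]
    omega
  rw [stepFun, hsum, Finset.sum_range_sub, add_sub_cancel]

theorem ae_ne_of_countable {ι : Type*} [Countable ι] (a : ι → ℝ) :
    ∀ᵐ x : ℝ, ∀ s, x ≠ a s :=
  ae_all_iff.2 fun s => compl_mem_ae_iff.2 (measure_singleton (a s))

theorem tendsto_stepFun {M : ℕ} {c : ℕ → E3} {a : ℕ → Fin M → ℝ} {d : ℕ → Fin M → E3} {c₀ : E3}
    {a₀ : Fin M → ℝ} {d₀ : Fin M → E3} (hc : Tendsto c atTop (𝓝 c₀))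
    (ha : ∀ s, Tendsto (fun n => a n s) atTop (𝓝 (a₀ s)))
    (hd : ∀ s, Tendsto (fun n => d n s) atTop (𝓝 (d₀ s))) {x : ℝ} (hx : ∀ s, x ≠ a₀ s) :
    Tendsto (fun n => stepFun (c n) (a n) (d n) x) atTop (𝓝 (stepFun c₀ a₀ d₀ x)) := by
  refine hc.add (tendsto_finsetSum _ fun s _ => ?_)
  rcases lt_or_gt_of_ne (hx s) with h | h
  · rw [if_neg (not_le.2 h)]
    refine tendsto_const_nhds.congr' ?_
    filter_upwards [(ha s).eventually_const_lt h] with n hn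
    rw [if_neg (not_le.2 hn)]
  · rw [if_pos h.le]
    refine (hd s).congr' ?_
    filter_upwards [(ha s).eventually_lt_const h] with n hn
    rw [if_pos hn.le]

/-- Compactness of sequences of step functions with a bounded number of values. -/
theorem exists_subseq_tendsto_stepFun {Q : Set E3} (hQ : IsCompact Q) {M : ℕ} {S : ℕ → ℝ → ℕ}
    (hS : ∀ n, Monotone (S n)) (hSM : ∀ n x, S n x ≤ M) {p : ℕ → ℕ → E3} (hp : ∀ n s, p n s ∈ Q) :
    ∃ φ : ℕ → ℕ, StrictMono φ ∧ ∃ (c : E3) (a : Fin M → ℝ) (d : Fin M → E3),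
      (∀ s, a s ∈ Set.Icc (0 : ℝ) 1) ∧ ∀ᵐ x : ℝ, x ∈ Set.Ioo (0 : ℝ) 1 →
        Tendsto (fun n => p (φ n) (S (φ n) x)) atTop (𝓝 (stepFun c a d x)) := by
  choose a ha hrep using fun n => exists_stepFun_eq (hS n) (hSM n) (p n)
  have hK : IsCompact ((Set.univ.pi fun _ : Fin M => Set.Icc (0 : ℝ) 1) ×ˢ
      (Set.univ.pi fun _ : ℕ => Q)) :=
    (isCompact_univ_pi fun _ => isCompact_Icc).prod (isCompact_univ_pi fun _ => hQ)
  obtain ⟨⟨a₀, p₀⟩, hmem, φ, hφ, hlim⟩ := hK.tendsto_subseq (x := fun n => (a n, p n))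
    fun n => ⟨fun s _ => ha n s, fun s _ => hp n s⟩
  have hla : ∀ s, Tendsto (fun n => a (φ n) s) atTop (𝓝 (a₀ s)) :=
    tendsto_pi_nhds.1 ((continuous_fst.tendsto _).comp hlim)
  have hlp : ∀ s, Tendsto (fun n => p (φ n) s) atTop (𝓝 (p₀ s)) :=
    tendsto_pi_nhds.1 ((continuous_snd.tendsto _).comp hlim)
  refine ⟨φ, hφ, p₀ 0, a₀, fun s => p₀ (s + 1) - p₀ s, fun s => hmem.1 s (Set.mem_univ s), ?_⟩
  -- Two countable sets are removed: the limit jumps, where convergence may fail, and the jumps of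
  -- all approximants, where the representation may fail.
  filter_upwards [ae_ne_of_countable a₀,
    ae_ne_of_countable fun i : ℕ × Fin M => a i.1 i.2] with x hx₀ hx hx01
  refine (tendsto_stepFun (hlp 0) hla (fun s => (hlp (s + 1)).sub (hlp s)) hx₀).congr fun n => ?_
  exact (hrep (φ n) x hx01 fun s => hx (φ n, s)).symm

/-! ### The total variation of a step function of the first variable -/

theorem eq_zero_of_tsupport_subset {φ : ℝ × ℝ → E3} (h : tsupport φ ⊆ Omega) {x : ℝ × ℝ}
    (hx : x ∉ Omega) : φ x = 0 := image_eq_zero_of_notMem_tsupport fun hx' => hx (h hx')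

theorem fderiv_eq_zero_of_tsupport_subset {φ : ℝ × ℝ → E3} (h : tsupport φ ⊆ Omega)
    {x : ℝ × ℝ} (hx : x ∉ Omega) : fderiv ℝ φ x = 0 :=
  image_eq_zero_of_notMem_tsupport fun hx' => hx (h (tsupport_fderiv_subset ℝ hx'))

/-- The divergence of a field with two columns. -/
noncomputable def divergence (φ₁ φ₂ : ℝ × ℝ → E3) (x : ℝ × ℝ) : E3 :=
  fderiv ℝ φ₁ x (1, 0) + fderiv ℝ φ₂ x (0, 1)

theorem continuous_divergence {φ₁ φ₂ : ℝ × ℝ → E3} (h₁ : ContDiff ℝ 1 φ₁) (h₂ : ContDiff ℝ 1 φ₂) :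
    Continuous (divergence φ₁ φ₂) :=
  ((h₁.continuous_fderiv one_ne_zero).clm_apply continuous_const).add
    ((h₂.continuous_fderiv one_ne_zero).clm_apply continuous_const)

theorem integrable_divergence {φ₁ φ₂ : ℝ × ℝ → E3} (h₁ : ContDiff ℝ 1 φ₁)
    (hs₁ : HasCompactSupport φ₁) (h₂ : ContDiff ℝ 1 φ₂) (hs₂ : HasCompactSupport φ₂) :
    Integrable (divergence φ₁ φ₂) :=
  (continuous_divergence h₁ h₂).integrable_of_hasCompactSupport
    ((hs₁.fderiv_apply ℝ (1, 0)).add (hs₂.fderiv_apply ℝ (0, 1)))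

theorem measurableSet_Omega : MeasurableSet Omega := measurableSet_Ioo.prod measurableSet_Ioo

/-- By the divergence theorem on `[a,1] × [0,1]`, the left-hand side equals `-∫ ⟨d, φ₁(a, y)⟩ dy`:
the other three sides lie outside the open square, where the fields vanish. -/
theorem integral_step_divergence_le {φ₁ φ₂ : ℝ × ℝ → E3}
    (h₁ : ContDiff ℝ 1 φ₁ ∧ HasCompactSupport φ₁ ∧ tsupport φ₁ ⊆ Omega)
    (h₂ : ContDiff ℝ 1 φ₂ ∧ HasCompactSupport φ₂ ∧ tsupport φ₂ ⊆ Omega)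
    (hle : ∀ x, ‖φ₁ x‖ ^ 2 + ‖φ₂ x‖ ^ 2 ≤ 1) {a : ℝ} (ha : a ∈ Set.Icc (0 : ℝ) 1) (d : E3) :
    ∫ x, inner ℝ (if a ≤ x.1 then d else 0) (divergence φ₁ φ₂ x) ∂muOmega ≤ ‖d‖ := by
  set F : ℝ × ℝ → ℝ := fun x => inner ℝ d (divergence φ₁ φ₂ x) with hF
  have hF0 : ∀ x, x ∉ Omega → F x = 0 := by
    intro x hx
    simp [hF, divergence, fderiv_eq_zero_of_tsupport_subset h₁.2.2 hx,
      fderiv_eq_zero_of_tsupport_subset h₂.2.2 hx]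
  have hFc : Continuous F := continuous_const.inner (continuous_divergence h₁.1 h₂.1)
  have heq : ∫ x, inner ℝ (if a ≤ x.1 then d else 0) (divergence φ₁ φ₂ x) ∂muOmega =
      ∫ x in Set.Icc (a, (0 : ℝ)) (1, 1), F x := by
    rw [muOmega, ← integral_indicator measurableSet_Omega, ← integral_indicator measurableSet_Icc]
    congr 1
    ext x
    by_cases hx : x ∈ Omega
    · rw [Set.indicator_of_mem hx]
      by_cases hax : a ≤ x.1
      · rw [if_pos hax, Set.indicator_of_mem]
        exact ⟨⟨hax, hx.2.1.le⟩, ⟨hx.1.2.le, hx.2.2.le⟩⟩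
      · rw [if_neg hax, inner_zero_left, Set.indicator_of_notMem]
        exact fun h => hax h.1.1
    · rw [Set.indicator_of_notMem hx]
      by_cases hxI : x ∈ Set.Icc (a, (0 : ℝ)) (1, 1)
      · rw [Set.indicator_of_mem hxI, hF0 x hx]
      · rw [Set.indicator_of_notMem hxI]
  have hder : ∀ {φ : ℝ × ℝ → E3}, ContDiff ℝ 1 φ → ∀ x,
      HasFDerivAt (fun x => (inner ℝ d (φ x) : ℝ)) ((innerSL ℝ d).comp (fderiv ℝ φ x)) x :=
    fun hφ x => (innerSL ℝ d).hasFDerivAt.comp x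
      ((hφ.differentiable one_ne_zero) x).hasFDerivAt
  have hdiv := integral_divergence_prod_Icc_of_hasFDerivAt_off_countable_of_le
    (fun x => (inner ℝ d (φ₁ x) : ℝ)) (fun x => (inner ℝ d (φ₂ x) : ℝ))
    (fun x => (innerSL ℝ d).comp (fderiv ℝ φ₁ x)) (fun x => (innerSL ℝ d).comp (fderiv ℝ φ₂ x))
    (a, 0) (1, 1) ⟨ha.2, zero_le_one⟩ ∅ Set.countable_empty
    (continuous_const.inner h₁.1.continuous).continuousOn
    (continuous_const.inner h₂.1.continuous).continuousOn
    (fun x _ => hder h₁.1 x) (fun x _ => hder h₂.1 x)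
    (by
      refine (hFc.continuousOn.congr fun x _ => ?_).integrableOn_compact isCompact_Icc
      simp [hF, divergence, inner_add_right])
  have hFeq : ∀ x, ((innerSL ℝ d).comp (fderiv ℝ φ₁ x)) (1, 0) +
      ((innerSL ℝ d).comp (fderiv ℝ φ₂ x)) (0, 1) = F x := by
    intro x
    simp [hF, divergence, inner_add_right]
  simp only [hFeq] at hdiv
  have hb1 : ∀ x, φ₂ (x, 1) = 0 := fun x => eq_zero_of_tsupport_subset h₂.2.2 fun h => by
    exact absurd h.2.2 (lt_irrefl _)
  have hb0 : ∀ x, φ₂ (x, 0) = 0 := fun x => eq_zero_of_tsupport_subset h₂.2.2 fun h => by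
    exact absurd h.2.1 (lt_irrefl _)
  have hr : ∀ y, φ₁ (1, y) = 0 := fun y => eq_zero_of_tsupport_subset h₁.2.2 fun h => by
    exact absurd h.1.2 (lt_irrefl _)
  simp only [hb1, hb0, hr, inner_zero_right, intervalIntegral.integral_zero, sub_zero, zero_add,
    zero_sub] at hdiv
  rw [heq, hdiv]
  have hφ : ∀ x, ‖φ₁ x‖ ≤ 1 := fun x => by
    have := hle x
    have := sq_nonneg ‖φ₂ x‖
    exact (sq_le_one_iff₀ (norm_nonneg _)).1 (by linarith)
  have hbound := intervalIntegral.norm_integral_le_of_norm_le_const (a := (0 : ℝ)) (b := 1)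
    (f := fun y => (inner ℝ d (φ₁ (a, y)) : ℝ)) (C := ‖d‖) fun y _ => by
      exact (norm_inner_le_norm _ _).trans (mul_le_of_le_one_right (norm_nonneg _) (hφ _))
  rw [sub_zero, abs_one, mul_one, Real.norm_eq_abs] at hbound
  exact (neg_le_abs _).trans hbound

theorem variation_congr {f g : ℝ × ℝ → E3} (h : f =ᵐ[muOmega] g) : variation f = variation g := by
  have hint : ∀ φ : ℝ × ℝ → E3, ∫ x, inner ℝ (f x) (φ x) ∂muOmega =
      ∫ x, inner ℝ (g x) (φ x) ∂muOmega := fun φ =>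
    integral_congr_ae (h.mono fun x hx => by simp only [hx])
  simp only [variation, hint]

theorem variation_stepFun_lt_top {M : ℕ} (c : E3) {a : Fin M → ℝ} (ha : ∀ s, a s ∈ Set.Icc (0 : ℝ) 1)
    (d : Fin M → E3) : variation (fun x => stepFun c a d x.1) < ⊤ := by
  refine lt_of_le_of_lt ?_ (ENNReal.ofReal_lt_top (r := ‖c‖ + ∑ s, ‖d s‖))
  refine iSup_le fun φ₁ => iSup_le fun φ₂ => iSup_le fun h₁ => iSup_le fun h₂ => iSup_le fun hle =>
    ENNReal.ofReal_le_ofReal ?_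
  change ∫ x, inner ℝ (stepFun c a d x.1) (divergence φ₁ φ₂ x) ∂muOmega ≤ _
  have hint : ∀ (b : ℝ) (e : E3), Integrable
      (fun x : ℝ × ℝ => (inner ℝ (if b ≤ x.1 then e else 0) (divergence φ₁ φ₂ x) : ℝ)) muOmega := by
    intro b e
    have h : Integrable (fun x => (inner ℝ e (divergence φ₁ φ₂ x) : ℝ)) muOmega :=
      ((integrable_divergence h₁.1 h₁.2.1 h₂.1 h₂.2.1).const_inner e).restrict
    refine (h.indicator (measurableSet_le measurable_const measurable_fst :
      MeasurableSet {x : ℝ × ℝ | b ≤ x.1})).congr (Eventually.of_forall fun x => ?_)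
    by_cases hx : b ≤ x.1
    · simp only [Set.indicator_of_mem (show x ∈ {x : ℝ × ℝ | b ≤ x.1} from hx), if_pos hx]
    · simp only [Set.indicator_of_notMem (show x ∉ {x : ℝ × ℝ | b ≤ x.1} from hx), if_neg hx,
        inner_zero_left]
  -- On `Ω` the constant `c` is itself a step with jump point 0, so the same estimate covers it.
  have heq : ∫ x, inner ℝ (stepFun c a d x.1) (divergence φ₁ φ₂ x) ∂muOmega =
      ∫ x, (inner ℝ (if (0 : ℝ) ≤ x.1 then c else 0) (divergence φ₁ φ₂ x) +
        ∑ s, inner ℝ (if a s ≤ x.1 then d s else 0) (divergence φ₁ φ₂ x)) ∂muOmega := by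
    refine setIntegral_congr_fun measurableSet_Omega fun x hx => ?_
    simp only [stepFun, if_pos hx.1.1.le, inner_add_left, sum_inner]
  rw [heq, integral_add (hint 0 c) (integrable_finsetSum _ fun s _ => hint (a s) (d s)),
    integral_finsetSum _ fun s _ => hint (a s) (d s)]
  exact add_le_add (integral_step_divergence_le h₁ h₂ hle ⟨le_rfl, zero_le_one⟩ c)
    (Finset.sum_le_sum fun s _ => integral_step_divergence_le h₁ h₂ hle (ha s) (d s))

/-! ### Compactness -/

theorem ae_fst_muOmega {P : ℝ → Prop} (h : ∀ᵐ x : ℝ, x ∈ Set.Ioo (0 : ℝ) 1 → P x) :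
    ∀ᵐ x ∂muOmega, P x.1 := by
  have h' : ∀ᵐ x : ℝ × ℝ, x.1 ∈ Set.Ioo (0 : ℝ) 1 → P x.1 :=
    (Measure.quasiMeasurePreserving_fst (μ := (volume : Measure ℝ))
      (ν := (volume : Measure ℝ))).ae h
  rw [muOmega, ae_restrict_iff' measurableSet_Omega]
  exact h'.mono fun x hx hxO => hx hxO.1

theorem muOmega_univ : muOmega Set.univ = 1 := by
  rw [muOmega, Measure.restrict_apply_univ, Omega, Measure.volume_eq_prod, Measure.prod_prod,
    Real.volume_Ioo]
  simp

instance : IsProbabilityMeasure muOmega := ⟨muOmega_univ⟩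

theorem measurable_stepFun {M : ℕ} (c : E3) (a : Fin M → ℝ) (d : Fin M → E3) :
    Measurable (stepFun c a d) :=
  measurable_const.add (Finset.measurable_sum _ fun _ _ =>
    Measurable.ite measurableSet_Ici measurable_const measurable_const)

/-- Functions that are asymptotically close in `L¹` to step functions of the first variable, with
values in a compact set and a bounded number of jumps, are precompact. -/
theorem exists_subseq_tendsto_Lp {Q : Set E3} (hQ : IsCompact Q) {M : ℕ} {S : ℕ → ℝ → ℕ}
    (hS : ∀ n, Monotone (S n)) (hSM : ∀ n x, S n x ≤ M) {p : ℕ → ℕ → E3} (hp : ∀ n s, p n s ∈ Q)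
    {z : ℕ → Lp E3 1 muOmega}
    (hz : Tendsto (fun n => ∫⁻ x, ‖z n x - p n (S n x.1)‖ₑ ∂muOmega) atTop (𝓝 0)) :
    ∃ φ : ℕ → ℕ, StrictMono φ ∧ ∃ zlim : Lp E3 1 muOmega,
      Tendsto (fun n => z (φ n)) atTop (𝓝 zlim) ∧ MemBV Q zlim ∧
        ∃ v : ℝ → E3, zlim =ᵐ[muOmega] fun x => v x.1 := by
  obtain ⟨φ, hφ, c, a, d, ha, hlim⟩ := exists_subseq_tendsto_stepFun hQ hS hSM hp
  have hlim' := ae_fst_muOmega hlim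
  set v : ℝ × ℝ → E3 := fun x => stepFun c a d x.1 with hv
  have hvm : Measurable v := (measurable_stepFun c a d).comp measurable_fst
  have hvQ : ∀ᵐ x ∂muOmega, v x ∈ Q := hlim'.mono fun x hx =>
    hQ.isClosed.mem_of_tendsto hx (Eventually.of_forall fun n => hp _ _)
  obtain ⟨B, hB⟩ := hQ.isBounded.exists_norm_le
  have hvL : MemLp v 1 muOmega :=
    (memLp_top_of_bound hvm.aestronglyMeasurable B (hvQ.mono fun x hx => hB _ hx)).mono_exponent
      le_top
  have hstepm : ∀ n, Measurable fun x : ℝ × ℝ => p n (S n x.1) := fun n =>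
    (measurable_from_nat (f := p n)).comp ((hS n).measurable.comp measurable_fst)
  have hsteps : Tendsto (fun n => ∫⁻ x, ‖p (φ n) (S (φ n) x.1) - v x‖ₑ ∂muOmega) atTop (𝓝 0) := by
    have h := tendsto_lintegral_of_dominated_convergence (μ := muOmega)
      (F := fun n x => ‖p (φ n) (S (φ n) x.1) - v x‖ₑ) (f := fun _ => 0)
      (fun _ => ENNReal.ofReal (B + B))
      (fun n => ((hstepm (φ n)).sub hvm).enorm)
      (fun n => hvQ.mono fun x hx => by
        simp only [← ofReal_norm]
        exact ENNReal.ofReal_le_ofReal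
          ((norm_sub_le _ _).trans (add_le_add (hB _ (hp _ _)) (hB _ hx))))
      (by simp)
      (hlim'.mono fun x hx => by
        have := (hx.sub_const (v x)).enorm
        simpa [hv] using this)
    simpa using h
  have hae : hvL.toLp v =ᵐ[muOmega] v := hvL.coeFn_toLp
  refine ⟨φ, hφ, hvL.toLp v, ?_, ⟨?_, ?_⟩, stepFun c a d, hae⟩
  · rw [Lp.tendsto_Lp_iff_tendsto_eLpNorm]
    have hsum := (hz.comp hφ.tendsto_atTop).add hsteps
    rw [add_zero] at hsum
    refine tendsto_of_tendsto_of_tendsto_of_le_of_le tendsto_const_nhds hsum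
      (fun _ => zero_le) fun n => ?_
    simp only [Function.comp_apply]
    have hm : Measurable fun x => ‖p (φ n) (S (φ n) x.1) - v x‖ₑ :=
      ((hstepm (φ n)).sub hvm).enorm
    rw [eLpNorm_one_eq_lintegral_enorm, ← lintegral_add_right _ hm]
    refine lintegral_mono fun x => ?_
    calc ‖(z (φ n) - v) x‖ₑ
        = ‖(z (φ n) x - p (φ n) (S (φ n) x.1)) + (p (φ n) (S (φ n) x.1) - v x)‖ₑ := by
          rw [sub_add_sub_cancel]; rfl
      _ ≤ _ := enorm_add_le _ _
  · rw [variation_congr hae]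
    exact variation_stepFun_lt_top c ha d
  · filter_upwards [hae, hvQ] with x hx hxQ
    rwa [hx]

/-- The infimum need not be attained; `|C| + 1` makes the bound positive and strictly larger, so
some competitor lies below it. -/
theorem exists_spinField_of_energyHG_le {l r J C : ℝ} (hl : 0 < l) (hr : 0 < r) {G : E3 → ℝ}
    {z : Lp E3 1 muOmega}
    (hz : energyHG l (r ^ 2) J G z ≤ ENNReal.ofReal (C * l * r ^ 3)) :
    ∃ u, IsSpinField l u ∧ z =ᵐ[muOmega] chirality l (r ^ 2) u ∧
      energyH l (r ^ 2) J u + energyP l (r ^ 2) G u ≤ (|C| + 1) * l * r ^ 3 := by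
  have hlt : energyHG l (r ^ 2) J G z < ENNReal.ofReal ((|C| + 1) * l * r ^ 3) := by
    refine hz.trans_lt ((ENNReal.ofReal_lt_ofReal_iff (by positivity)).2 ?_)
    gcongr
    linarith [le_abs_self C]
  simp only [energyHG, iInf_lt_iff] at hlt
  obtain ⟨u, hu, hzu, h⟩ := hlt
  exact ⟨u, hu, hzu, ((ENNReal.ofReal_lt_ofReal_iff (by positivity)).1 h).le⟩

theorem exists_steps_tendsto {k : ℕ} (hk : 1 ≤ k) {q : Fin k → E3} (hq : ∀ j, ‖q j‖ = 1)
    {G : E3 → ℝ} (hG : IsPenalty q G) {c C : ℝ} (hc : 0 < c) (hC : 0 ≤ C) {l r J : ℕ → ℝ}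
    (hl : ∀ n, 0 < l n) (hl0 : Tendsto l atTop (𝓝 0)) (hr : ∀ n, 0 < r n)
    (hr0 : Tendsto r atTop (𝓝 0)) (hlr : Tendsto (fun n => l n / r n) atTop (𝓝 0))
    (hJ : ∀ n, c ≤ J n * (l n / r n)) {u : ℕ → ℤ × ℤ → E3} (hu : ∀ n, IsSpinField (l n) (u n))
    (hE : ∀ n, energyH (l n) (r n ^ 2) (J n) (u n) + energyP (l n) (r n ^ 2) G (u n) ≤
      C * l n * r n ^ 3) :
    ∃ M : ℕ, ∃ S : ℕ → ℝ → ℕ, (∀ n, Monotone (S n)) ∧ (∀ n x, S n x ≤ M) ∧ ∃ p : ℕ → ℕ → E3,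
      (∀ n s, p n s ∈ wells q) ∧
      Tendsto (fun n => ∫⁻ x, ‖chirality (l n) (r n ^ 2) (u n) x - p n (S n x.1)‖ₑ ∂muOmega)
        atTop (𝓝 0) := by
  obtain ⟨M, K, hK, ρ, hρ, r₀, hr₀, happ⟩ := exists_step_approx hk hq hG hc hC
  have hall : ∀ n, ∃ S : ℤ → ℕ, Monotone S ∧ (∀ j, S j ≤ M) ∧ ∃ p : ℕ → E3,
      (∀ s, p s ∈ wells q) ∧ (l n ≤ 1 / 8 → r n ≤ r₀ → ∀ η κ, 0 < η → η ≤ ρ → 0 < κ →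
          (∀ a b c : E3, ‖a‖ = 1 → ‖b‖ = 1 → ‖c‖ = 1 →
            (∀ p ∈ wells q, η ≤ dist (chi (r n ^ 2) a b) p) →
              κ * (r n ^ 2) ^ 2 ≤ density (r n ^ 2) G a b c) →
          ∫⁻ x, ‖chirality (l n) (r n ^ 2) (u n) x - p (S ⌊x.1 / l n⌋)‖ₑ ∂muOmega ≤
            ENNReal.ofReal (η + K * (l n / r n + √(l n / r n) + l n) +
              K / κ * (l n / r n))) := by
    intro n
    by_cases h : l n ≤ 1 / 8 ∧ r n ≤ r₀
    · obtain ⟨S, hS, hSM, p, hp, H⟩ :=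
        happ (l n) (r n) (J n) (hl n) h.1 (hr n) h.2 (hJ n) (u n) (hu n) (hE n)
      exact ⟨S, hS, hSM, p, hp, fun _ _ => H⟩
    -- Only large `n` matter for the limit; the other indices get trivial data.
    · exact ⟨fun _ => 0, monotone_const, fun _ => Nat.zero_le _, fun _ => q ⟨0, hk⟩,
        fun _ => ⟨⟨0, hk⟩, Or.inl rfl⟩, fun h1 h2 => absurd ⟨h1, h2⟩ h⟩
  choose S hS hSM p hp H using hall
  refine ⟨M, fun n x => S n ⌊x / l n⌋, fun n x y hxy =>
    hS n (Int.floor_mono (div_le_div_of_nonneg_right hxy (hl n).le)), fun n x => hSM n _, p, hp, ?_⟩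
  rw [ENNReal.tendsto_nhds_zero]
  intro ε hε
  obtain ⟨η₀, hη₀, hη₀ε⟩ : ∃ η₀ : ℝ, 0 < η₀ ∧ ENNReal.ofReal η₀ ≤ ε := by
    rcases eq_or_ne ε ⊤ with rfl | htop
    · exact ⟨1, one_pos, le_top⟩
    · exact ⟨ε.toReal, ENNReal.toReal_pos hε.ne' htop, ENNReal.ofReal_toReal_le⟩
  set η : ℝ := min (η₀ / 2) (min ρ 1) with hη
  have hη0 : 0 < η := by positivity
  -- `κ` depends on `η` but not on `n`, so `K / κ * (l n / r n)` still tends to zero.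
  obtain ⟨κ, hκ, d₀, hd₀, hcoer⟩ := hG.density_coercive hq hη0
    ((min_le_right _ _).trans (min_le_right _ _))
  have hlim : Tendsto (fun n => K * (l n / r n + √(l n / r n) + l n) + K / κ * (l n / r n))
      atTop (𝓝 0) := by
    have h := (((hlr.add hlr.sqrt).add hl0).const_mul K).add (hlr.const_mul (K / κ))
    simpa using h
  have hr2 : Tendsto (fun n => r n ^ 2) atTop (𝓝 0) := by simpa using hr0.pow 2
  filter_upwards [hl0.eventually_le_const (by norm_num : (0 : ℝ) < 1 / 8),
    hr0.eventually_le_const hr₀, hr2.eventually_le_const hd₀,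
    hlim.eventually_le_const (half_pos hη₀)] with n h1 h2 h3 h4
  have hrn : 0 < r n ^ 2 := pow_pos (hr n) 2
  refine (H n h1 h2 η κ hη0 ((min_le_right _ _).trans (min_le_left _ _)) hκ
    (hcoer _ hrn h3)).trans (le_trans (ENNReal.ofReal_le_ofReal ?_) hη₀ε)
  have : η ≤ η₀ / 2 := min_le_left _ _
  linarith

end HelicalXY

theorem proposition4p1
    (k : ℕ) (hk : 1 ≤ k) (q : Fin k → E3) (hq : Function.Injective q) (hq1 : ∀ l, ‖q l‖ = 1)
    (G : E3 → ℝ) (hG : IsPenalty q G)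
    (lam del J : ℕ → ℝ) (hlam : ∀ n, 0 < lam n) (hlam0 : Tendsto lam atTop (𝓝 0))
    (hdel : ∀ n, 0 < del n) (hdel0 : Tendsto del atTop (𝓝 0))
    (hscale : Tendsto (fun n => lam n / Real.sqrt (del n)) atTop (𝓝 0))
    (c : ℝ) (hc : 0 < c) (hJ : ∀ n, c ≤ J n * (lam n / Real.sqrt (del n)))
    (C : ℝ) (z : ℕ → Lp E3 1 muOmega)
    (hz : ∀ n, energyHG (lam n) (del n) (J n) G (z n) ≤
      ENNReal.ofReal (C * lam n * del n ^ (3 / 2 : ℝ))) :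
    ∃ φ : ℕ → ℕ, StrictMono φ ∧
      ∃ zlim : Lp E3 1 muOmega,
        Tendsto (fun n => z (φ n)) atTop (𝓝 zlim) ∧
        MemBV (wells q) zlim ∧
        ∃ v : ℝ → E3, zlim =ᵐ[muOmega] fun x => v x.1 := by
  -- Working with `r = √δ` turns `δ^(3/2)` into the integer power `r³`.
  have hr : ∀ n, 0 < √(del n) := fun n => Real.sqrt_pos.2 (hdel n)
  have hr2 : ∀ n, √(del n) ^ 2 = del n := fun n => Real.sq_sqrt (hdel n).le
  have hr3 : ∀ n, del n ^ (3 / 2 : ℝ) = √(del n) ^ 3 := fun n => by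
    rw [Real.sqrt_eq_rpow, ← Real.rpow_natCast, ← Real.rpow_mul (hdel n).le]
    norm_num
  have hu : ∀ n, ∃ u, IsSpinField (lam n) u ∧ z n =ᵐ[muOmega] chirality (lam n) (√(del n) ^ 2) u ∧
      energyH (lam n) (√(del n) ^ 2) (J n) u + energyP (lam n) (√(del n) ^ 2) G u ≤
        (|C| + 1) * lam n * √(del n) ^ 3 := fun n =>
    exists_spinField_of_energyHG_le (hlam n) (hr n) (by rw [hr2, ← hr3]; exact hz n)
  choose u hspin hzu hE using hu
  have hr0 : Tendsto (fun n => √(del n)) atTop (𝓝 0) := by simpa using hdel0.sqrt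
  obtain ⟨M, S, hS, hSM, p, hp, hlim⟩ := exists_steps_tendsto hk hq1 hG hc
    (by positivity : 0 ≤ |C| + 1) hlam hlam0 hr hr0 hscale hJ hspin hE
  refine exists_subseq_tendsto_Lp (finite_wells q).isCompact hS hSM hp (hlim.congr fun n => ?_)
  exact lintegral_congr_ae ((hzu n).mono fun x hx => by simp only [hx])
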